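/- Let $\mathcal V=\mathbb Q\langle e_0,e_1\rangle$ be the free associative algebra, graded by $\deg e_0=\deg e_1=1$, and let $\mathfrak{lie}(e_0,e_1)\subset\mathcal V$ be the Lie subalgebra generated by $e_0,e_1$ for the commutator; $(x|w)$ denotes the coefficient of the word $w$ in $x\in\mathcal V$, and $\wedge$ denotes degree completion (product of the homogeneous components). For $\nu\in\mathbb Q$ and $v\in\mathcal V$ let $\mathrm{der}^{(1)}_{(\nu,v)}$ be the derivation of $\mathcal V$ with $e_0\mapsto\nu e_0+[v,e_0]$, $e_1\mapsto\nu e_1$, and let $\mathrm{der}^{(10)}_{(\nu,v)}(a)=\mathrm{der}^{(1)}_{(\nu,v)}(a)+av$. Put $$\langle v,w\rangle=\mathrm{der}^{(1)}_{(0,v)}(w)-\mathrm{der}^{(1)}_{(0,w)}(v)+[w,v],\qquad \theta(x)=x-(x|e_0)e_0+\sum_{n\ge1}\tfrac1n(x|e_0^{n-1}e_1)e_1^n ,$$ and let $\mathfrak g^{\mathrm{DR}}=\mathbb Q1\ltimes(\mathfrak{lie}(e_0,e_1)^\wedge,\langle\,,\rangle)$, where $1$ acts by multiplying each homogeneous element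 by its degree. Let $\mathcal W=\mathbb Q\oplus\mathcal Ve_1\subset\mathcal V$, a subalgebra freely generated by $\tilde y_n=e_0^{n-1}e_1$ $(n\ge1)$, and set $\tilde y_0=-1$. Let $\Delta^{\mathcal W}:\mathcal W\to\mathcal W\otimes\mathcal W$ be the algebra morphism with $\Delta^{\mathcal W}(\tilde y_n)=-\sum_{i=0}^n\tilde y_i\otimes\tilde y_{n-i}$ for $n\ge1$. Let $\mathcal M=\mathcal V/\mathcal Ve_0$, which is a free $\mathcal W$-module generated by the class $1_{\mathcal M}$ of $1$, and let $\Delta^{\mathcal M}:\mathcal M\to\mathcal M\otimes\mathcal M$ be the linear map with $\Delta^{\mathcal M}(w\cdot1_{\mathcal M})=\Delta^{\mathcal W}(w)\cdot(1_{\mathcal M}\otimes1_{\mathcal M})$ for $w\in\mathcal W$. Both maps preserve degrees; denote their completions by $\hat\Delta^{\mathcal W,\mathrm{DR}}$ and $\hat\Delta^{\mathcal M,\mathrm{DR}}$. For $(\nu,x)\in\mathfrak g^{\mathrm{DR}}$ (so $\nu\in\mathbb Q$, $x\in\mathfrak{lie}(e_0,e_1)^\wedge$), $\mathrm{der}^{(1)}_{(\nu,\theta(x))}$,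 extended to the completion, restricts to a derivation $D^{\mathcal W}_{(\nu,x)}$ of $\mathcal W^\wedge$, and $\mathrm{der}^{(10)}_{(\nu,\theta(x))}$ induces an endomorphism $D^{\mathcal M}_{(\nu,x)}$ of $\mathcal M^\wedge$. For $\mathcal X\in\{\mathcal W,\mathcal M\}$ define the Lie subalgebra $$\mathfrak{stab}(\hat\Delta^{\mathcal X,\mathrm{DR}})=\{g\in\mathfrak g^{\mathrm{DR}}\mid(D^{\mathcal X}_g\otimes\mathrm{id}+\mathrm{id}\otimes D^{\mathcal X}_g)\circ\hat\Delta^{\mathcal X,\mathrm{DR}}=\hat\Delta^{\mathcal X,\mathrm{DR}}\circ D^{\mathcal X}_g\}.$$ **Theorem.** The Lie subalgebras $\mathfrak{stab}(\hat\Delta^{\mathcal W,\mathrm{DR}})$ and $\mathfrak{stab}(\hat\Delta^{\mathcal M,\mathrm{DR}})$ of $\mathfrak g^{\mathrm{DR}}$ are equal. -/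

import Mathlib

noncomputable section

namespace HarmonicStab

open scoped TensorProduct
open Finset.HasAntidiagonal (antidiagonal)

/-- The free associative `ℚ`-algebra on two generators `e0`, `e1`. -/
abbrev V : Type := FreeAlgebra ℚ (Fin 2)

/-- The generator `e₀`. -/
def e0 : V := FreeAlgebra.ι ℚ 0

/-- The generator `e₁`. -/
def e1 : V := FreeAlgebra.ι ℚ 1

/-- The degree `n` component of `V`, where `e0` and `e1` have degree `1`: the span of the products of
`n` generators. -/
def Vdeg (n : ℕ) : Submodule ℚ V := Submodule.span ℚ {e0, e1} ^ n

/-- `V` with the commutator bracket `a * b - b * a` (only used to speak of Lie polynomials). -/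
instance instLieRingV : LieRing V := LieRing.ofAssociativeRing

/-- `lie(e₀,e₁)`: the Lie subalgebra of `V` generated by `e0` and `e1` for the commutator bracket. -/
def lieAlg : LieSubalgebra ℚ V := LieSubalgebra.lieSpan ℚ V {e0, e1}

/-- The degree `n` component of `lie(e₀,e₁)`. -/
def lieDeg (n : ℕ) : Submodule ℚ V := lieAlg.toSubmodule ⊓ Vdeg n

theorem V_induction {p : V → Prop} (h1 : ∀ r : ℚ, p (algebraMap ℚ V r)) (he0 : p e0) (he1 : p e1)
    (hmul : ∀ a b, p a → p b → p (a * b)) (hadd : ∀ a b, p a → p b → p (a + b)) (a : V) : p a :=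
  FreeAlgebra.induction ℚ (Fin 2) h1 (fun i => by fin_cases i; exacts [he0, he1]) hmul hadd a

/-- The derivation of `V` with `e0 ↦ a0` and `e1 ↦ a1`; see `freeDer_e0`, `freeDer_e1`, `freeDer_mul`
and `der_ext`. -/
def freeDer (a0 a1 : V) : V →ₗ[ℚ] V :=
  TrivSqZeroExt.sndHom V V |>.restrictScalars ℚ |>.comp
    (FreeAlgebra.lift ℚ (fun i : Fin 2 =>
      (TrivSqZeroExt.inl (FreeAlgebra.ι ℚ i) + TrivSqZeroExt.inr (![a0, a1] i) :
        TrivSqZeroExt V V))).toLinearMap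

theorem freeDer_e0 (a0 a1 : V) : freeDer a0 a1 e0 = a0 := by
  simp [freeDer, e0]

theorem freeDer_e1 (a0 a1 : V) : freeDer a0 a1 e1 = a1 := by
  simp [freeDer, e1]

theorem freeDer_mul (a0 a1 a b : V) :
    freeDer a0 a1 (a * b) = freeDer a0 a1 a * b + a * freeDer a0 a1 b := by
  have h : ∀ x : V, ((FreeAlgebra.lift ℚ (fun i : Fin 2 =>
      (TrivSqZeroExt.inl (FreeAlgebra.ι ℚ i) + TrivSqZeroExt.inr (![a0, a1] i) :
        TrivSqZeroExt V V))) x).fst = x := by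
    intro x
    have : ((TrivSqZeroExt.fstHom ℚ V V).comp (FreeAlgebra.lift ℚ (fun i : Fin 2 =>
      (TrivSqZeroExt.inl (FreeAlgebra.ι ℚ i) + TrivSqZeroExt.inr (![a0, a1] i) :
        TrivSqZeroExt V V)))) = AlgHom.id ℚ V := by
      ext i; simp
    exact DFunLike.congr_fun this x
  simp only [freeDer, LinearMap.comp_apply, AlgHom.toLinearMap_apply, map_mul,
    LinearMap.coe_restrictScalars, TrivSqZeroExt.sndHom_apply, TrivSqZeroExt.snd_mul, h,
    smul_eq_mul, MulOpposite.smul_eq_mul_unop, MulOpposite.unop_op]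
  abel

theorem freeDer_algebraMap (a0 a1 : V) (r : ℚ) : freeDer a0 a1 (algebraMap ℚ V r) = 0 := by
  simp [freeDer, TrivSqZeroExt.algebraMap_eq_inl']

theorem der_ext (D D' : V →ₗ[ℚ] V) (h0 : D e0 = D' e0) (h1 : D e1 = D' e1)
    (hD : ∀ a b, D (a * b) = D a * b + a * D b) (hD' : ∀ a b, D' (a * b) = D' a * b + a * D' b) :
    D = D' := by
  have one : ∀ D : V →ₗ[ℚ] V, (∀ a b, D (a * b) = D a * b + a * D b) → D 1 = 0 := by
    intro D h
    have := h 1 1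
    simpa using this
  ext a
  induction a using V_induction with
  | h1 r => simp [Algebra.algebraMap_eq_smul_one, one D hD, one D' hD']
  | he0 => exact h0
  | he1 => exact h1
  | hmul a b ha hb => rw [hD, hD', ha, hb]
  | hadd a b ha hb => rw [map_add, map_add, ha, hb]

theorem freeDer_add (a0 a1 b0 b1 : V) :
    freeDer (a0 + b0) (a1 + b1) = freeDer a0 a1 + freeDer b0 b1 := by
  apply der_ext
  · simp [freeDer_e0]
  · simp [freeDer_e1]
  · exact freeDer_mul _ _
  · intro a b
    simp only [LinearMap.add_apply, freeDer_mul]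
    noncomm_ring

theorem freeDer_smul (c : ℚ) (a0 a1 : V) :
    freeDer (c • a0) (c • a1) = c • freeDer a0 a1 := by
  apply der_ext
  · simp [freeDer_e0]
  · simp [freeDer_e1]
  · exact freeDer_mul _ _
  · intro a b
    simp only [LinearMap.smul_apply, freeDer_mul, smul_add, smul_mul_assoc, mul_smul_comm]

/-- For `u = (ν, v)`, the derivation `der_u^{V,(1)}` of the algebra `V` such that
`e0 ↦ ν e0 + [v, e0]` and `e1 ↦ ν e1`. For `ν = 0` this is `der_v^{V,(1)}`; for `u = (1, 0)` it is the
grading derivation (`der1_one_zero`). -/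
def der1 : (ℚ × V) →ₗ[ℚ] Module.End ℚ V where
  toFun u := freeDer (u.1 • e0 + (u.2 * e0 - e0 * u.2)) (u.1 • e1)
  map_add' u u' := by
    rw [← freeDer_add]
    congr 1
    · simp only [Prod.fst_add, Prod.snd_add, add_smul, add_mul, mul_add]; abel
    · simp only [Prod.fst_add, add_smul]
  map_smul' c u := by
    simp only [RingHom.id_apply]
    rw [← freeDer_smul]
    congr 1
    · simp [smul_add, smul_sub, mul_smul]
    · simp [mul_smul]

theorem der1_e0 (u : ℚ × V) : der1 u e0 = u.1 • e0 + (u.2 * e0 - e0 * u.2) := freeDer_e0 _ _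
theorem der1_e1 (u : ℚ × V) : der1 u e1 = u.1 • e1 := freeDer_e1 _ _
theorem der1_mul (u : ℚ × V) (a b : V) : der1 u (a * b) = der1 u a * b + a * der1 u b :=
  freeDer_mul _ _ a b
theorem der1_algebraMap (u : ℚ × V) (r : ℚ) : der1 u (algebraMap ℚ V r) = 0 :=
  freeDer_algebraMap _ _ r

/-- For `u = (ν, v)`, the endomorphism `der_u^{V,(10)} : a ↦ der_u^{V,(1)}(a) + a v` of `V`. -/
def der10 : (ℚ × V) →ₗ[ℚ] Module.End ℚ V :=
  der1 + (LinearMap.mul ℚ V).flip ∘ₗ LinearMap.snd ℚ ℚ V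

theorem der10_apply (u : ℚ × V) (a : V) : der10 u a = der1 u a + a * u.2 := rfl

/-- The bracket on `ℚ × V` with `⟨(0,v),(0,v')⟩ = (0, ⟨v,v'⟩)` in which `(1,0)` acts by the grading. -/
def emBr (u u' : ℚ × V) : ℚ × V :=
  (0, der1 u u'.2 - der1 u' u.2 + (u'.2 * u.2 - u.2 * u'.2))

theorem der1_emBr (u u' : ℚ × V) :
    der1 (emBr u u') = der1 u * der1 u' - der1 u' * der1 u := by
  apply der_ext
  · simp only [der1_e0, emBr, LinearMap.sub_apply, Module.End.mul_apply, map_add, map_sub,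
      map_smul, der1_mul]
    simp only [smul_add, smul_sub, zero_smul, mul_add, add_mul, mul_sub, sub_mul, mul_smul_comm,
      smul_mul_assoc, mul_assoc, smul_smul, mul_comm u'.1 u.1]
    abel
  · simp only [der1_e1, emBr, LinearMap.sub_apply, Module.End.mul_apply, map_smul, zero_smul,
      smul_smul, mul_comm u'.1 u.1, sub_self]
  · exact der1_mul _
  · intro a b
    simp only [LinearMap.sub_apply, Module.End.mul_apply, map_add, der1_mul]
    noncomm_ring

theorem der10_emBr (u u' : ℚ × V) :
    der10 (emBr u u') = der10 u * der10 u' - der10 u' * der10 u := by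
  apply LinearMap.ext
  intro a
  simp only [der10_apply, der1_emBr, Module.End.mul_apply, LinearMap.sub_apply, map_add, der1_mul]
  simp only [emBr]
  noncomm_ring


theorem e0_mem : e0 ∈ Vdeg 1 := by
  rw [Vdeg, pow_one]; exact Submodule.subset_span (by simp)

theorem e1_mem : e1 ∈ Vdeg 1 := by
  rw [Vdeg, pow_one]; exact Submodule.subset_span (by simp)

theorem Vdeg_mul {m n : ℕ} {a b : V} (ha : a ∈ Vdeg m) (hb : b ∈ Vdeg n) :
    a * b ∈ Vdeg (m + n) := by
  rw [Vdeg, pow_add]; exact Submodule.mul_mem_mul ha hb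

theorem Vdeg_succ_induction {n : ℕ} {p : V → Prop} (h0 : ∀ a ∈ Vdeg n, p (a * e0))
    (h1 : ∀ a ∈ Vdeg n, p (a * e1)) (hadd : ∀ a b, p a → p b → p (a + b)) {a : V}
    (ha : a ∈ Vdeg (n + 1)) : p a := by
  rw [Vdeg, pow_succ] at ha
  refine Submodule.mul_induction_on ha (fun m hm x hx => ?_) hadd
  obtain ⟨c, d, rfl⟩ := Submodule.mem_span_pair.1 hx
  rw [mul_add]
  refine hadd _ _ ?_ ?_
  · have := h0 (c • m) (Submodule.smul_mem _ _ hm)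
    simpa using this
  · have := h1 (d • m) (Submodule.smul_mem _ _ hm)
    simpa using this

theorem mem_Vdeg_zero {a : V} (ha : a ∈ Vdeg 0) : ∃ r : ℚ, a = algebraMap ℚ V r := by
  rw [Vdeg, pow_zero] at ha
  obtain ⟨r, hr⟩ := Submodule.mem_one.1 ha
  exact ⟨r, hr.symm⟩

theorem der1_mem {d m : ℕ} {u : ℚ × V} (hu : u.2 ∈ Vdeg d) (hu' : d ≠ 0 → u.1 = 0) {a : V}
    (ha : a ∈ Vdeg m) : der1 u a ∈ Vdeg (d + m) := by
  have hs : ∀ b ∈ Vdeg 1, u.1 • b ∈ Vdeg (d + 1) := by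
    intro b hb
    rcases Nat.eq_zero_or_pos d with rfl | h
    · rw [zero_add]; exact Submodule.smul_mem _ _ hb
    · rw [hu' h.ne', zero_smul]; exact Submodule.zero_mem _
  have h0 : der1 u e0 ∈ Vdeg (d + 1) := by
    rw [der1_e0]
    refine Submodule.add_mem _ (hs _ e0_mem) (Submodule.sub_mem _ (Vdeg_mul hu e0_mem) ?_)
    rw [add_comm]; exact Vdeg_mul e0_mem hu
  have h1 : der1 u e1 ∈ Vdeg (d + 1) := by
    rw [der1_e1]; exact hs _ e1_mem
  induction m generalizing a with
  | zero =>
    obtain ⟨r, rfl⟩ := mem_Vdeg_zero ha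
    rw [der1_algebraMap]; exact Submodule.zero_mem _
  | succ m ih =>
    refine Vdeg_succ_induction (p := fun a => der1 u a ∈ Vdeg (d + (m + 1))) ?_ ?_ ?_ ha
    · intro b hb
      rw [der1_mul]
      refine Submodule.add_mem _ (show _ ∈ Vdeg (d + m + 1) from Vdeg_mul (ih hb) e0_mem) ?_
      have := Vdeg_mul hb h0
      rwa [show m + (d + 1) = d + (m + 1) by omega] at this
    · intro b hb
      rw [der1_mul]
      refine Submodule.add_mem _ (show _ ∈ Vdeg (d + m + 1) from Vdeg_mul (ih hb) e1_mem) ?_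
      have := Vdeg_mul hb h1
      rwa [show m + (d + 1) = d + (m + 1) by omega] at this
    · intro a b ha hb
      rw [map_add]; exact Submodule.add_mem _ ha hb

theorem der1_one_zero {m : ℕ} {a : V} (ha : a ∈ Vdeg m) :
    der1 (1, 0) a = (m : ℚ) • a := by
  induction m generalizing a with
  | zero =>
    obtain ⟨r, rfl⟩ := mem_Vdeg_zero ha
    simp [der1_algebraMap]
  | succ m ih =>
    refine Vdeg_succ_induction (p := fun a => der1 (1, 0) a = ((m + 1 : ℕ) : ℚ) • a) ?_ ?_ ?_ ha
    · intro b hb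
      rw [der1_mul, ih hb, der1_e0]
      simp [add_smul]
    · intro b hb
      rw [der1_mul, ih hb, der1_e1]
      simp [add_smul]
    · intro a b ha hb
      rw [map_add, ha, hb, smul_add]

/-- `coeff w x = (x|w)`, the coefficient of the word `w` in `x`. -/
def coeff (w : FreeMonoid (Fin 2)) : V →ₗ[ℚ] ℚ := (FreeAlgebra.basisFreeMonoid ℚ (Fin 2)).coord w

theorem basis_eq (w : FreeMonoid (Fin 2)) : FreeAlgebra.basisFreeMonoid ℚ (Fin 2) w =
    FreeMonoid.lift (FreeAlgebra.ι ℚ) w := by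
  simp [FreeAlgebra.basisFreeMonoid, FreeAlgebra.equivMonoidAlgebraFreeMonoid]

theorem coeff_basis (w w' : FreeMonoid (Fin 2)) :
    coeff w (FreeAlgebra.basisFreeMonoid ℚ (Fin 2) w') = Finsupp.single w' (1 : ℚ) w := by
  rw [coeff, Module.Basis.coord_apply, Module.Basis.repr_self]

theorem basis_mul (w : FreeMonoid (Fin 2)) (i : Fin 2) :
    FreeAlgebra.basisFreeMonoid ℚ (Fin 2) w * FreeAlgebra.ι ℚ i =
      FreeAlgebra.basisFreeMonoid ℚ (Fin 2) (w * FreeMonoid.of i) := by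
  simp [basis_eq]

theorem word_inj (w w' : FreeMonoid (Fin 2)) (i j : Fin 2) :
    w' * FreeMonoid.of i = w * FreeMonoid.of j ↔ w' = w ∧ i = j := by
  constructor
  · intro h
    have h' := congrArg FreeMonoid.toList h
    simp only [FreeMonoid.toList_mul, FreeMonoid.toList_of] at h'
    have := List.append_inj' h' rfl
    exact ⟨FreeMonoid.toList.injective this.1, by simpa using this.2⟩
  · rintro ⟨rfl, rfl⟩; rfl

theorem word_ne_one (w : FreeMonoid (Fin 2)) (i : Fin 2) : w * FreeMonoid.of i ≠ 1 := by
  intro h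
  have := congrArg FreeMonoid.length h
  simp at this

theorem algebraMap_eq_basis (r : ℚ) :
    algebraMap ℚ V r = r • FreeAlgebra.basisFreeMonoid ℚ (Fin 2) 1 := by
  rw [basis_eq, map_one, Algebra.algebraMap_eq_smul_one]

theorem coeff_word_algebraMap (w : FreeMonoid (Fin 2)) (j : Fin 2) (r : ℚ) :
    coeff (w * FreeMonoid.of j) (algebraMap ℚ V r) = 0 := by
  rw [algebraMap_eq_basis, map_smul, coeff_basis, Finsupp.single_eq_of_ne (word_ne_one _ _),
    smul_zero]

theorem coeff_one_algebraMap (r : ℚ) : coeff 1 (algebraMap ℚ V r) = r := by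
  rw [algebraMap_eq_basis, map_smul, coeff_basis, Finsupp.single_eq_same, smul_eq_mul, mul_one]

theorem coeff_mul_gen (w : FreeMonoid (Fin 2)) (i j : Fin 2) (a : V) :
    coeff (w * FreeMonoid.of j) (a * FreeAlgebra.ι ℚ i) = if i = j then coeff w a else 0 := by
  have : (coeff (w * FreeMonoid.of j)) ∘ₗ (LinearMap.mulRight ℚ (FreeAlgebra.ι ℚ i)) =
      if i = j then coeff w else 0 := by
    apply (FreeAlgebra.basisFreeMonoid ℚ (Fin 2)).ext
    intro w'
    rw [LinearMap.comp_apply, LinearMap.mulRight_apply, basis_mul, coeff_basis]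
    classical
    rw [Finsupp.single_apply, word_inj]
    by_cases hij : i = j <;> simp [hij, coeff_basis, Finsupp.single_apply]
  have h := LinearMap.congr_fun this a
  rw [LinearMap.comp_apply, LinearMap.mulRight_apply] at h
  rw [h]; split_ifs <;> rfl

theorem coeff_one_mul_gen (i : Fin 2) (a : V) : coeff 1 (a * FreeAlgebra.ι ℚ i) = 0 := by
  have : (coeff 1) ∘ₗ (LinearMap.mulRight ℚ (FreeAlgebra.ι ℚ i)) = 0 := by
    apply (FreeAlgebra.basisFreeMonoid ℚ (Fin 2)).ext
    intro w'
    rw [LinearMap.comp_apply, LinearMap.mulRight_apply, basis_mul, coeff_basis,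
      Finsupp.single_eq_of_ne (word_ne_one _ _).symm]
    rfl
  exact LinearMap.congr_fun this a

theorem coeff_e0 (w : FreeMonoid (Fin 2)) (a : V) :
    coeff (w * FreeMonoid.of 0) (a * e0) = coeff w a := by
  rw [e0, coeff_mul_gen, if_pos rfl]

theorem coeff_e1 (w : FreeMonoid (Fin 2)) (a : V) :
    coeff (w * FreeMonoid.of 1) (a * e1) = coeff w a := by
  rw [e1, coeff_mul_gen, if_pos rfl]

theorem coeff_e01 (w : FreeMonoid (Fin 2)) (a : V) :
    coeff (w * FreeMonoid.of 0) (a * e1) = 0 := by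
  rw [e1, coeff_mul_gen, if_neg (by decide)]

theorem coeff_e10 (w : FreeMonoid (Fin 2)) (a : V) :
    coeff (w * FreeMonoid.of 1) (a * e0) = 0 := by
  rw [e0, coeff_mul_gen, if_neg (by decide)]

theorem V_right_induction {p : V → Prop} (h1 : ∀ r : ℚ, p (algebraMap ℚ V r))
    (he0 : ∀ a, p a → p (a * e0)) (he1 : ∀ a, p a → p (a * e1))
    (hadd : ∀ a b, p a → p b → p (a + b)) (hsmul : ∀ (r : ℚ) a, p a → p (r • a)) (a : V) :
    p a := by
  have : ∀ a b : V, p b → p (b * a) := by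
    intro a
    induction a using V_induction with
    | h1 r =>
      intro b hb
      rw [← Algebra.commutes, ← Algebra.smul_def]; exact hsmul _ _ hb
    | he0 => exact he0
    | he1 => exact he1
    | hmul a b ha hb => intro c hc; rw [← mul_assoc]; exact hb _ (ha _ hc)
    | hadd a b ha hb => intro c hc; rw [mul_add]; exact hadd _ _ (ha _ hc) (hb _ hc)
  have h := this a 1 (by simpa using h1 1)
  rwa [one_mul] at h

theorem coeff_of_mem {n : ℕ} {a : V} (ha : a ∈ Vdeg n) (w : FreeMonoid (Fin 2))
    (hw : w.length ≠ n) : coeff w a = 0 := by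
  induction n generalizing a w with
  | zero =>
    obtain ⟨r, rfl⟩ := mem_Vdeg_zero ha
    rw [algebraMap_eq_basis, map_smul, coeff_basis, Finsupp.single_eq_of_ne, smul_zero]
    rintro rfl; exact hw rfl
  | succ n ih =>
    have key : ∀ (i : Fin 2), ∀ b ∈ Vdeg n, coeff w (b * FreeAlgebra.ι ℚ i) = 0 := by
      intro i b hb
      rcases List.eq_nil_or_concat (FreeMonoid.toList w) with h | ⟨l, j, h⟩
      · have : w = 1 := FreeMonoid.toList.injective h
        rw [this, coeff_one_mul_gen]
      · have : w = FreeMonoid.ofList l * FreeMonoid.of j := by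
          apply FreeMonoid.toList.injective; rw [h]; simp
        subst this
        rw [coeff_mul_gen]
        split_ifs
        · refine ih hb _ ?_
          intro h'
          apply hw
          rw [FreeMonoid.length_mul, h', FreeMonoid.length_of]
        · rfl
    refine Vdeg_succ_induction (p := fun a => coeff w a = 0) (key 0) (key 1) ?_ ha
    intro a b ha hb
    rw [map_add, ha, hb, add_zero]

/-- The word `e₀ⁿ e₁`. -/
def wordY (n : ℕ) : FreeMonoid (Fin 2) := FreeMonoid.of 0 ^ n * FreeMonoid.of 1

theorem wordY_length (n : ℕ) : (wordY n).length = n + 1 := by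
  have : ∀ n : ℕ, (FreeMonoid.of (0 : Fin 2) ^ n).length = n := by
    intro n
    induction n with
    | zero => rfl
    | succ n ih => rw [pow_succ, FreeMonoid.length_mul, ih, FreeMonoid.length_of]
  rw [wordY, FreeMonoid.length_mul, this, FreeMonoid.length_of]

theorem wordY_injective : Function.Injective wordY := by
  intro m n h
  have := congrArg FreeMonoid.length h
  rw [wordY_length, wordY_length] at this
  omega

theorem finite_coeff_wordY (x : V) : (Function.support fun n => coeff (wordY n) x).Finite := by
  have h : (((FreeAlgebra.basisFreeMonoid ℚ (Fin 2)).repr x).support :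
    Set (FreeMonoid (Fin 2))).Finite := Finset.finite_toSet _
  refine (h.preimage wordY_injective.injOn).subset ?_
  intro n hn
  simpa [coeff] using hn

theorem finite_theta (x : V) : (Function.support fun n : ℕ =>
    (1 / ((n : ℚ) + 1) * coeff (wordY n) x) • e1 ^ (n + 1)).Finite := by
  refine (finite_coeff_wordY x).subset ?_
  intro n hn h
  apply hn
  simp only [h, mul_zero, zero_smul]

/-- The map `θ(x) = x - (x|e₀) e₀ + ∑_{m ≥ 1} (1/m) (x|e₀^{m-1}e₁) e₁^m`; the sum, written with
`m = n + 1`, is finite by `finite_theta`. -/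
def theta : V →ₗ[ℚ] V where
  toFun x := x - coeff (FreeMonoid.of 0) x • e0 +
    ∑ᶠ n : ℕ, (1 / ((n : ℚ) + 1) * coeff (wordY n) x) • e1 ^ (n + 1)
  map_add' x y := by
    have : ∀ n : ℕ, (1 / ((n : ℚ) + 1) * coeff (wordY n) (x + y)) • e1 ^ (n + 1) =
        (1 / ((n : ℚ) + 1) * coeff (wordY n) x) • e1 ^ (n + 1) +
        (1 / ((n : ℚ) + 1) * coeff (wordY n) y) • e1 ^ (n + 1) := by
      intro n; rw [map_add, mul_add, add_smul]
    rw [finsum_congr this, finsum_add_distrib (finite_theta x) (finite_theta y), map_add, add_smul]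
    abel
  map_smul' c x := by
    have : ∀ n : ℕ, (1 / ((n : ℚ) + 1) * coeff (wordY n) (c • x)) • e1 ^ (n + 1) =
        c • ((1 / ((n : ℚ) + 1) * coeff (wordY n) x) • e1 ^ (n + 1)) := by
      intro n; rw [map_smul, smul_smul, smul_eq_mul]; congr 1; ring
    rw [finsum_congr this, ← smul_finsum' c (finite_theta x), map_smul, RingHom.id_apply]
    simp only [smul_add, smul_sub, smul_smul, smul_eq_mul]

theorem e1_pow_mem (n : ℕ) : e1 ^ n ∈ Vdeg n := by
  induction n with
  | zero => rw [Vdeg, pow_zero, pow_zero]; exact Submodule.one_le.1 le_rfl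
  | succ n ih => rw [pow_succ]; exact Vdeg_mul ih e1_mem

theorem theta_mem {n : ℕ} {x : V} (hx : x ∈ Vdeg n) : theta x ∈ Vdeg n := by
  refine Submodule.add_mem _ (Submodule.sub_mem _ hx ?_) ?_
  · by_cases h : n = 1
    · subst h; exact Submodule.smul_mem _ _ e0_mem
    · rw [coeff_of_mem hx _ (by rw [FreeMonoid.length_of]; omega), zero_smul]
      exact Submodule.zero_mem _
  · refine finsum_induction (p := fun y => y ∈ Vdeg n) (Submodule.zero_mem _)
      (fun _ _ => Submodule.add_mem _) ?_
    intro k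
    by_cases h : n = k + 1
    · subst h; exact Submodule.smul_mem _ _ (e1_pow_mem _)
    · rw [coeff_of_mem hx _ (by rw [wordY_length]; omega), mul_zero, zero_smul]
      exact Submodule.zero_mem _


/-- `emBr` as a bilinear map. -/
def emBrL : (ℚ × V) →ₗ[ℚ] (ℚ × V) →ₗ[ℚ] (ℚ × V) := LinearMap.mk₂ ℚ emBr
  (fun u u' w => by
    simp only [emBr, map_add, LinearMap.add_apply, Prod.snd_add, mul_add, add_mul, Prod.mk_add_mk,
      add_zero]
    congr 1; abel)
  (fun c u w => by
    simp only [emBr, map_smul, LinearMap.smul_apply, Prod.smul_snd, mul_smul_comm, smul_mul_assoc,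
      Prod.smul_mk, smul_zero, smul_sub, smul_add])
  (fun u w w' => by
    simp only [emBr, map_add, LinearMap.add_apply, Prod.snd_add, mul_add, add_mul, Prod.mk_add_mk,
      add_zero]
    congr 1; abel)
  (fun c u w => by
    simp only [emBr, map_smul, LinearMap.smul_apply, Prod.smul_snd, mul_smul_comm, smul_mul_assoc,
      Prod.smul_mk, smul_zero, smul_sub, smul_add])

/-- The bracket `⟨v,w⟩ = der_v^{V,(1)}(w) - der_w^{V,(1)}(v) + [w, v]`. -/
def ihara : V →ₗ[ℚ] V →ₗ[ℚ] V := LinearMap.mk₂ ℚ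
  (fun v w => der1 (0, v) w - der1 (0, w) v + (w * v - v * w))
  (fun v v' w => by
    rw [show ((0 : ℚ), v + v') = (0, v) + (0, v') by simp]
    simp only [map_add, LinearMap.add_apply, mul_add, add_mul]; abel)
  (fun c v w => by
    rw [show ((0 : ℚ), c • v) = c • (0, v) by simp]
    simp only [map_smul, LinearMap.smul_apply, mul_smul_comm, smul_mul_assoc, smul_sub, smul_add])
  (fun v w w' => by
    rw [show ((0 : ℚ), w + w') = (0, w) + (0, w') by simp]
    simp only [map_add, LinearMap.add_apply, mul_add, add_mul]; abel)
  (fun c v w => by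
    rw [show ((0 : ℚ), c • w) = c • (0, w) by simp]
    simp only [map_smul, LinearMap.smul_apply, mul_smul_comm, smul_mul_assoc, smul_sub, smul_add])

theorem ihara_apply (v w : V) :
    ihara v w = der1 (0, v) w - der1 (0, w) v + (w * v - v * w) := rfl

theorem ihara_skew (v w : V) : ihara w v = - ihara v w := by
  simp only [ihara_apply]; abel

theorem emBr_zero (v w : V) : emBr (0, v) (0, w) = (0, ihara v w) := rfl

theorem der10_injective {u u' : ℚ × V} (h1 : u.1 = u'.1) (h : der10 u = der10 u') : u = u' := by
  have := LinearMap.congr_fun h 1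
  have h0 : ∀ u : ℚ × V, der1 u 1 = 0 := fun u => by
    have := der1_algebraMap u 1
    rwa [map_one] at this
  simp only [der10_apply, h0, one_mul, zero_add] at this
  exact Prod.ext h1 this

theorem ihara_leibniz (x y z : V) :
    ihara x (ihara y z) = ihara (ihara x y) z + ihara y (ihara x z) := by
  have : ((0 : ℚ), ihara x (ihara y z)) = (0, ihara (ihara x y) z + ihara y (ihara x z)) := by
    apply der10_injective
    · rfl
    rw [show ((0 : ℚ), ihara (ihara x y) z + ihara y (ihara x z)) =
      (0, ihara (ihara x y) z) + (0, ihara y (ihara x z)) by simp, map_add]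
    simp only [← emBr_zero, der10_emBr]
    noncomm_ring
  exact (Prod.mk.inj this).2

theorem e0_mem_lie : e0 ∈ lieAlg := LieSubalgebra.subset_lieSpan (by simp)

theorem e1_mem_lie : e1 ∈ lieAlg := LieSubalgebra.subset_lieSpan (by simp)

theorem comm_mem_lie {x y : V} (hx : x ∈ lieAlg) (hy : y ∈ lieAlg) : x * y - y * x ∈ lieAlg :=
  lieAlg.lie_mem hx hy

theorem lie_induction {p : V → Prop} (h0 : p e0) (h1 : p e1) (hz : p 0)
    (hadd : ∀ x y, p x → p y → p (x + y)) (hsmul : ∀ (c : ℚ) x, p x → p (c • x))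
    (hlie : ∀ x y, p x → p y → p (x * y - y * x)) {x : V} (hx : x ∈ lieAlg) : p x := by
  refine LieSubalgebra.lieSpan_induction ℚ (p := fun x _ => p x) ?_ hz
    (fun x y _ _ => hadd x y) (fun c x _ => hsmul c x) (fun x y _ _ => hlie x y) hx
  rintro x (rfl | rfl)
  exacts [h0, h1]

theorem der1_mem_lie {x y : V} (hx : x ∈ lieAlg) (hy : y ∈ lieAlg) : der1 (0, x) y ∈ lieAlg := by
  have : y ∈ lieAlg ∧ der1 (0, x) y ∈ lieAlg := by
    refine lie_induction (p := fun y => y ∈ lieAlg ∧ der1 (0, x) y ∈ lieAlg) ?_ ?_ ?_ ?_ ?_ ?_ hy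
    · refine ⟨e0_mem_lie, ?_⟩
      rw [der1_e0, zero_smul, zero_add]
      exact comm_mem_lie hx e0_mem_lie
    · refine ⟨e1_mem_lie, ?_⟩
      rw [der1_e1, zero_smul]
      exact zero_mem _
    · rw [map_zero]; exact ⟨zero_mem _, zero_mem _⟩
    · rintro y z ⟨hy, hy'⟩ ⟨hz, hz'⟩
      rw [map_add]; exact ⟨add_mem hy hz, add_mem hy' hz'⟩
    · rintro c y ⟨hy, hy'⟩
      rw [map_smul]; exact ⟨lieAlg.smul_mem c hy, lieAlg.smul_mem c hy'⟩
    · rintro y z ⟨hy, hy'⟩ ⟨hz, hz'⟩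
      refine ⟨comm_mem_lie hy hz, ?_⟩
      rw [map_sub, der1_mul, der1_mul]
      have := add_mem (comm_mem_lie hy' hz) (comm_mem_lie hy hz')
      convert this using 1
      abel
  exact this.2

theorem ihara_mem_lie {x y : V} (hx : x ∈ lieAlg) (hy : y ∈ lieAlg) : ihara x y ∈ lieAlg :=
  add_mem (sub_mem (der1_mem_lie hx hy) (der1_mem_lie hy hx)) (comm_mem_lie hy hx)

theorem ihara_mem_deg {m n : ℕ} {x y : V} (hx : x ∈ Vdeg m) (hy : y ∈ Vdeg n) :
    ihara x y ∈ Vdeg (m + n) := by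
  refine add_mem (sub_mem (der1_mem hx (fun _ => rfl) hy) ?_) (sub_mem ?_ (Vdeg_mul hx hy))
  · rw [add_comm]; exact der1_mem hy (fun _ => rfl) hx
  · rw [add_comm]; exact Vdeg_mul hy hx

theorem ihara_e0 (v : V) : ihara v e0 = 0 := by
  have : der1 (0, e0) = 0 := by
    apply der_ext
    · simp [der1_e0]
    · simp [der1_e1]
    · exact der1_mul _
    · simp
  rw [ihara_apply, this, der1_e0, zero_smul]
  simp

theorem ihara_e1_pow (v : V) (n : ℕ) : ihara v (e1 ^ n) = 0 := by
  have h : der1 (0, e1 ^ n) = LinearMap.mulLeft ℚ (e1 ^ n) - LinearMap.mulRight ℚ (e1 ^ n) := by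
    apply der_ext
    · simp [der1_e0]
    · simp [der1_e1, ← pow_succ, ← pow_succ']
    · exact der1_mul _
    · intro a b
      simp only [LinearMap.sub_apply, LinearMap.mulLeft_apply, LinearMap.mulRight_apply]
      noncomm_ring
  have h' : der1 (0, v) (e1 ^ n) = 0 := by
    induction n with
    | zero => rw [pow_zero, ← map_one (algebraMap ℚ V), der1_algebraMap]
    | succ n ih =>
      have ih' : der1 (0, v) (e1 ^ n) = 0 := by
        clear h ih
        induction n with
        | zero => rw [pow_zero, ← map_one (algebraMap ℚ V), der1_algebraMap]
        | succ n ih => rw [pow_succ, der1_mul, ih, der1_e1]; simp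
      rw [pow_succ, der1_mul, ih', der1_e1]; simp
  rw [ihara_apply, h, h']
  simp

theorem ihara_theta_right (v x : V) : ihara v (theta x) = ihara v x := by
  have h : ihara v (∑ᶠ n : ℕ, (1 / ((n : ℚ) + 1) * coeff (wordY n) x) • e1 ^ (n + 1)) = 0 := by
    refine finsum_induction (p := fun y => ihara v y = 0) (map_zero _)
      (fun a b ha hb => by rw [map_add, ha, hb, add_zero]) ?_
    intro n
    rw [map_smul, ihara_e1_pow, smul_zero]
  change ihara v (x - coeff (FreeMonoid.of 0) x • e0 + _) = _
  rw [map_add, h, add_zero, map_sub, map_smul, ihara_e0, smul_zero, sub_zero]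

theorem ihara_theta (x y : V) : ihara (theta x) (theta y) = ihara x y := by
  rw [ihara_theta_right, ihara_skew, ihara_theta_right, ihara_skew, neg_neg]

/-- The two-sided ideal generated by `e1`. -/
def I1 : Submodule ℚ V := ⊤ * Submodule.span ℚ {e1} * ⊤

theorem I1_induction {p : V → Prop} (h : ∀ a b, p (a * e1 * b))
    (hadd : ∀ a b, p a → p b → p (a + b)) {x : V} (hx : x ∈ I1) : p x := by
  refine Submodule.mul_induction_on hx (fun m hm b _ => ?_) hadd
  refine Submodule.mul_induction_on hm (fun a _ c hc => ?_) ?_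
  · obtain ⟨r, rfl⟩ := Submodule.mem_span_singleton.1 hc
    have := h (r • a) b
    simpa using this
  · intro x y hx hy
    rw [add_mul]; exact hadd _ _ hx hy

theorem mem_I1 (a b : V) : a * e1 * b ∈ I1 :=
  Submodule.mul_mem_mul (Submodule.mul_mem_mul Submodule.mem_top
    (Submodule.mem_span_singleton_self _)) Submodule.mem_top

theorem e1_mem_I1 : e1 ∈ I1 := by simpa using mem_I1 1 1

theorem I1_mul_left (c : V) {x : V} (hx : x ∈ I1) : c * x ∈ I1 := by
  refine I1_induction (p := fun x => c * x ∈ I1) (fun a b => ?_) ?_ hx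
  · rw [← mul_assoc, ← mul_assoc]; exact mem_I1 _ _
  · intro a b ha hb; rw [mul_add]; exact add_mem ha hb

theorem I1_mul_right (c : V) {x : V} (hx : x ∈ I1) : x * c ∈ I1 := by
  refine I1_induction (p := fun x => x * c ∈ I1) (fun a b => ?_) ?_ hx
  · rw [mul_assoc]; exact mem_I1 _ _
  · intro a b ha hb; rw [add_mul]; exact add_mem ha hb

theorem coeff_zeros_I1 (n : ℕ) {x : V} (hx : x ∈ I1) : coeff (FreeMonoid.of 0 ^ n) x = 0 := by
  refine I1_induction (p := fun x => coeff (FreeMonoid.of 0 ^ n) x = 0) (fun a b => ?_) ?_ hx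
  · have : ∀ n : ℕ, coeff (FreeMonoid.of 0 ^ n) (a * e1 * b) = 0 := by
      induction b using V_right_induction with
      | h1 r =>
        intro n
        rw [← Algebra.commutes, ← Algebra.smul_def, map_smul]
        rcases n with _ | n
        · rw [pow_zero, e1, coeff_one_mul_gen, smul_zero]
        · rw [pow_succ, coeff_e01, smul_zero]
      | he0 b ih =>
        intro n
        rw [← mul_assoc]
        rcases n with _ | n
        · rw [pow_zero, e0, coeff_one_mul_gen]
        · rw [pow_succ, coeff_e0, ih]
      | he1 b ih =>
        intro n
        rw [← mul_assoc]
        rcases n with _ | n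
        · rw [pow_zero, e1, coeff_one_mul_gen]
        · rw [pow_succ, coeff_e01]
      | hadd b c hb hc => intro n; rw [mul_add, map_add, hb, hc, add_zero]
      | hsmul r b hb => intro n; rw [mul_smul_comm, map_smul, hb, smul_zero]
    exact this n
  · intro a b ha hb; rw [map_add, ha, hb, add_zero]

theorem coeff_wordY_I2 (n : ℕ) {x : V} (hx : x ∈ I1 * I1) : coeff (wordY n) x = 0 := by
  refine Submodule.mul_induction_on hx (fun x hx y hy => ?_) ?_
  · refine I1_induction (p := fun y => coeff (wordY n) (x * y) = 0) (fun a b => ?_) ?_ hy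
    · rw [← mul_assoc]
      induction b using V_right_induction with
      | h1 r =>
        rw [← Algebra.commutes, ← Algebra.smul_def, map_smul, ← mul_assoc, wordY, coeff_e1,
          coeff_zeros_I1 n (I1_mul_right _ hx), smul_zero]
      | he0 b ih => rw [← mul_assoc, wordY, coeff_e10]
      | he1 b ih =>
        rw [← mul_assoc, wordY, coeff_e1, mul_assoc, mul_assoc]
        exact coeff_zeros_I1 n (I1_mul_right _ hx)
      | hadd b c hb hc => rw [mul_add, map_add, hb, hc, add_zero]
      | hsmul r b hb => rw [mul_smul_comm, map_smul, hb, smul_zero]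
    · intro a b ha hb; rw [mul_add, map_add, ha, hb, add_zero]
  · intro a b ha hb; rw [map_add, ha, hb, add_zero]

theorem theta_of_mem_I2 {x : V} (hx : x ∈ I1 * I1) : theta x = x := by
  have h1 : x ∈ I1 := by
    refine Submodule.mul_induction_on hx (fun x hx y _ => I1_mul_right _ hx)
      (fun _ _ => add_mem)
  change x - coeff (FreeMonoid.of 0) x • e0 +
    ∑ᶠ n : ℕ, (1 / ((n : ℚ) + 1) * coeff (wordY n) x) • e1 ^ (n + 1) = x
  have h2 : coeff (FreeMonoid.of 0) x = 0 := by
    have := coeff_zeros_I1 1 h1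
    rwa [pow_one] at this
  simp [coeff_wordY_I2 _ hx, h2]

theorem lie_sub_mem_I1 {x : V} (hx : x ∈ lieAlg) : ∃ c : ℚ, x - c • e0 ∈ I1 := by
  refine lie_induction (p := fun x => ∃ c : ℚ, x - c • e0 ∈ I1) ?_ ?_ ?_ ?_ ?_ ?_ hx
  · exact ⟨1, by simp⟩
  · exact ⟨0, by simpa using e1_mem_I1⟩
  · exact ⟨0, by simp⟩
  · rintro x y ⟨c, hc⟩ ⟨d, hd⟩
    refine ⟨c + d, ?_⟩
    rw [add_smul, add_sub_add_comm]; exact add_mem hc hd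
  · rintro r x ⟨c, hc⟩
    refine ⟨r * c, ?_⟩
    rw [mul_smul, ← smul_sub]; exact Submodule.smul_mem _ _ hc
  · rintro x y ⟨c, hc⟩ ⟨d, hd⟩
    refine ⟨0, ?_⟩
    have h : x * y - y * x - (0 : ℚ) • e0 = (x - c • e0) * y + c • (e0 * (y - d • e0))
        - (y * (x - c • e0) + c • ((y - d • e0) * e0)) := by
      simp only [sub_mul, mul_sub, smul_sub, zero_smul, smul_mul_assoc, mul_smul_comm]
      abel
    rw [h]
    exact sub_mem (add_mem (I1_mul_right _ hc) (Submodule.smul_mem _ _ (I1_mul_left _ hd)))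
      (add_mem (I1_mul_left _ hc) (Submodule.smul_mem _ _ (I1_mul_right _ hd)))

theorem der1_mem_I1 {x : V} (hx : x ∈ I1) (a : V) : der1 (0, x) a ∈ I1 := by
  induction a using V_induction with
  | h1 r => rw [der1_algebraMap]; exact zero_mem _
  | he0 =>
    rw [der1_e0, zero_smul, zero_add]; exact sub_mem (I1_mul_right _ hx) (I1_mul_left _ hx)
  | he1 => rw [der1_e1, zero_smul]; exact zero_mem _
  | hmul a b ha hb => rw [der1_mul]; exact add_mem (I1_mul_right _ ha) (I1_mul_left _ hb)
  | hadd a b ha hb => rw [map_add]; exact add_mem ha hb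

theorem der1_mem_I2 {x y : V} (hx : x ∈ I1) (hy : y ∈ I1) : der1 (0, x) y ∈ I1 * I1 := by
  refine I1_induction (p := fun y => der1 (0, x) y ∈ I1 * I1) (fun a b => ?_) ?_ hy
  · rw [der1_mul, der1_mul, der1_e1, zero_smul, mul_zero, add_zero, mul_assoc]
    refine add_mem (Submodule.mul_mem_mul (der1_mem_I1 hx _) (I1_mul_right _ e1_mem_I1))
      (Submodule.mul_mem_mul (I1_mul_left _ e1_mem_I1) (der1_mem_I1 hx _))
  · intro a b ha hb; rw [map_add]; exact add_mem ha hb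

theorem theta_ihara {x y : V} (hx : x ∈ lieAlg) (hy : y ∈ lieAlg) :
    theta (ihara x y) = ihara (theta x) (theta y) := by
  rw [ihara_theta]
  obtain ⟨c, hc⟩ := lie_sub_mem_I1 hx
  obtain ⟨d, hd⟩ := lie_sub_mem_I1 hy
  have h : ihara x y = ihara (x - c • e0) (y - d • e0) := by
    have h0 : ∀ v, ihara e0 v = 0 := fun v => by rw [ihara_skew, ihara_e0, neg_zero]
    simp [h0, ihara_e0]
  rw [h]
  apply theta_of_mem_I2
  exact add_mem (sub_mem (der1_mem_I2 hc hd) (der1_mem_I2 hd hc))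
    (sub_mem (Submodule.mul_mem_mul hd hc) (Submodule.mul_mem_mul hc hd))


theorem sum_assoc {X : Type*} [AddCommGroup X] (F : ℕ → ℕ → ℕ → X) (n : ℕ) :
    ∑ p ∈ antidiagonal n, ∑ q ∈ antidiagonal p.2, F p.1 q.1 q.2 =
      ∑ p ∈ antidiagonal n, ∑ q ∈ antidiagonal p.1, F q.1 q.2 p.2 := by
  rw [Finset.sum_sigma', Finset.sum_sigma']
  refine Finset.sum_nbij' (fun s => ⟨(s.1.1 + s.2.1, s.2.2), (s.1.1, s.2.1)⟩)
    (fun s => ⟨(s.2.1, s.2.2 + s.1.2), (s.2.2, s.1.2)⟩) ?_ ?_ ?_ ?_ ?_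
  · rintro ⟨⟨i, m⟩, ⟨j, k⟩⟩ h
    simp only [Finset.mem_sigma, Finset.HasAntidiagonal.mem_antidiagonal] at h ⊢
    exact ⟨by omega, by trivial⟩
  · rintro ⟨⟨m, k⟩, ⟨i, j⟩⟩ h
    simp only [Finset.mem_sigma, Finset.HasAntidiagonal.mem_antidiagonal] at h ⊢
    exact ⟨by omega, by trivial⟩
  · rintro ⟨⟨i, m⟩, ⟨j, k⟩⟩ h
    simp only [Finset.mem_sigma, Finset.HasAntidiagonal.mem_antidiagonal] at h
    obtain ⟨_, rfl⟩ := h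
    rfl
  · rintro ⟨⟨m, k⟩, ⟨i, j⟩⟩ h
    simp only [Finset.mem_sigma, Finset.HasAntidiagonal.mem_antidiagonal] at h
    obtain ⟨_, rfl⟩ := h
    rfl
  · rintro ⟨⟨i, m⟩, ⟨j, k⟩⟩ _
    rfl

theorem sum_comm3 {X : Type*} [AddCommGroup X] (F : ℕ → ℕ → ℕ → X) (n : ℕ) :
    ∑ p ∈ antidiagonal n, ∑ q ∈ antidiagonal p.2, F p.1 q.1 q.2 =
      ∑ p ∈ antidiagonal n, ∑ q ∈ antidiagonal p.2, F q.1 p.1 q.2 := by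
  rw [sum_assoc, sum_assoc (fun i j k => F j i k)]
  refine Finset.sum_congr rfl fun p _ => ?_
  exact (Finset.Nat.sum_antidiagonal_swap (f := fun q : ℕ × ℕ => F q.1 q.2 p.2)).symm

section Convolution

variable {X Y Z : Type*} [AddCommGroup X] [Module ℚ X] [AddCommGroup Y] [Module ℚ Y]
  [AddCommGroup Z] [Module ℚ Z]

/-- The extension of a bilinear map to sequences of homogeneous components: the component of degree
`n` of the result is the sum of `B (x i) (y j)` over `i + j = n`. -/
def conv (B : X →ₗ[ℚ] Y →ₗ[ℚ] Z) (x : ℕ → X) (y : ℕ → Y) : ℕ → Z :=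
  fun n => ∑ p ∈ antidiagonal n, B (x p.1) (y p.2)

theorem conv_add_left (B : X →ₗ[ℚ] Y →ₗ[ℚ] Z) (x x' : ℕ → X) (y : ℕ → Y) :
    conv B (x + x') y = conv B x y + conv B x' y := by
  funext n; simp [conv, Finset.sum_add_distrib]

theorem conv_add_right (B : X →ₗ[ℚ] Y →ₗ[ℚ] Z) (x : ℕ → X) (y y' : ℕ → Y) :
    conv B x (y + y') = conv B x y + conv B x y' := by
  funext n; simp [conv, Finset.sum_add_distrib]

theorem conv_smul_left (B : X →ₗ[ℚ] Y →ₗ[ℚ] Z) (c : ℚ) (x : ℕ → X) (y : ℕ → Y) :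
    conv B (c • x) y = c • conv B x y := by
  funext n; simp [conv, Finset.smul_sum]

theorem conv_smul_right (B : X →ₗ[ℚ] Y →ₗ[ℚ] Z) (c : ℚ) (x : ℕ → X) (y : ℕ → Y) :
    conv B x (c • y) = c • conv B x y := by
  funext n; simp [conv, Finset.smul_sum]

theorem conv_lie (br : X →ₗ[ℚ] X →ₗ[ℚ] X) (act : X →ₗ[ℚ] Y →ₗ[ℚ] Y)
    (h : ∀ x x' y, act x (act x' y) = act (br x x') y + act x' (act x y))
    (x x' : ℕ → X) (y : ℕ → Y) :
    conv act x (conv act x' y) = conv act (conv br x x') y + conv act x' (conv act x y) := by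
  funext n
  simp only [conv, map_sum, Pi.add_apply, LinearMap.sum_apply]
  rw [sum_comm3 (fun i j k => act (x' i) (act (x j) (y k))),
    ← sum_assoc (fun i j k => act (br (x i) (x' j)) (y k)), ← Finset.sum_add_distrib]
  refine Finset.sum_congr rfl fun p _ => ?_
  rw [← Finset.sum_add_distrib]
  exact Finset.sum_congr rfl fun q _ => h _ _ _

/-- For a sequence `T` of endomorphisms, `T n` being thought of as homogeneous of degree `n`, the
endomorphism `∑ₙ T n` of the degree completion. Elements of a degree completion are written as
sequences of homogeneous components, so
`hatOp T f n = ∑_{i+j=n} T i (f j)`. -/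
def hatOp (T : ℕ → Module.End ℚ X) (f : ℕ → X) : ℕ → X := conv LinearMap.id T f

theorem hatOp_apply (T : ℕ → Module.End ℚ X) (f : ℕ → X) (n : ℕ) :
    hatOp T f n = ∑ p ∈ antidiagonal n, T p.1 (f p.2) := rfl

/-- The homogeneous components of the commutator of `∑ T n` and `∑ S n`. -/
def commSeq (T S : ℕ → Module.End ℚ X) : ℕ → Module.End ℚ X :=
  fun n => ∑ p ∈ antidiagonal n, (T p.1 * S p.2 - S p.2 * T p.1)

theorem hatOp_commSeq (T S : ℕ → Module.End ℚ X) (f : ℕ → X) :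
    hatOp (commSeq T S) f = hatOp T (hatOp S f) - hatOp S (hatOp T f) := by
  rw [eq_sub_iff_add_eq]
  let br : Module.End ℚ X →ₗ[ℚ] Module.End ℚ X →ₗ[ℚ] Module.End ℚ X :=
    LinearMap.mul ℚ _ - (LinearMap.mul ℚ _).flip
  have h := conv_lie br LinearMap.id (fun x x' y => by
    simp [br, LinearMap.sub_apply]) T S f
  exact h.symm

/-- `T ↦ T ⊗ id + id ⊗ T`. -/
def tens : Module.End ℚ X →ₗ[ℚ] Module.End ℚ (X ⊗[ℚ] X) :=
  LinearMap.rTensorHom X + LinearMap.lTensorHom X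

theorem tens_apply (T : Module.End ℚ X) :
    tens T = TensorProduct.map T LinearMap.id + TensorProduct.map LinearMap.id T := rfl

theorem tens_comm (T S : Module.End ℚ X) :
    tens (T * S - S * T) = tens T * tens S - tens S * tens T := by
  ext x y
  simp [tens_apply]
  simp [TensorProduct.sub_tmul, TensorProduct.tmul_sub]
  abel

theorem tens_commSeq (T S : ℕ → Module.End ℚ X) :
    (fun n => tens (commSeq T S n)) = commSeq (fun n => tens (T n)) (fun n => tens (S n)) := by
  funext n
  simp only [commSeq, map_sum, tens_comm]

/-- Let `D = ∑ₙ T n` act on the completion `Xhat`, and let `Δ` be a linear map `X → X ⊗ X` which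
preserves degrees, with completion `Δ̂`. The condition `Stabilizes Xhat Δ T` says
`(D ⊗ id + id ⊗ D) ∘ Δ̂ = Δ̂ ∘ D` on `Xhat`. Both sides take values in the completion of `X ⊗ X`
for the total degree, and are compared component by component. -/
def Stabilizes (Xhat : Submodule ℚ (ℕ → X)) (Δ : X →ₗ[ℚ] X ⊗[ℚ] X) (T : ℕ → Module.End ℚ X) :
    Prop :=
  ∀ f ∈ Xhat, hatOp (fun n => tens (T n)) (fun n => Δ (f n)) = fun n => Δ (hatOp T f n)

variable {Xhat : Submodule ℚ (ℕ → X)} {Δ : X →ₗ[ℚ] X ⊗[ℚ] X}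

theorem Stabilizes.zero : Stabilizes Xhat Δ 0 := by
  intro f _
  funext n
  simp [hatOp_apply]

theorem Stabilizes.add {T S : ℕ → Module.End ℚ X} (hT : Stabilizes Xhat Δ T)
    (hS : Stabilizes Xhat Δ S) : Stabilizes Xhat Δ (T + S) := by
  intro f hf
  funext n
  have h1 := congrFun (hT f hf) n
  have h2 := congrFun (hS f hf) n
  simp only [hatOp_apply] at h1 h2 ⊢
  simp only [Pi.add_apply, map_add, LinearMap.add_apply, Finset.sum_add_distrib, h1, h2]

theorem Stabilizes.smul (c : ℚ) {T : ℕ → Module.End ℚ X} (hT : Stabilizes Xhat Δ T) :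
    Stabilizes Xhat Δ (c • T) := by
  intro f hf
  funext n
  have h1 := congrFun (hT f hf) n
  simp only [hatOp_apply] at h1 ⊢
  simp only [Pi.smul_apply, map_smul, LinearMap.smul_apply, ← Finset.smul_sum, h1]

theorem Stabilizes.comm {T S : ℕ → Module.End ℚ X} (hT : Stabilizes Xhat Δ T)
    (hS : Stabilizes Xhat Δ S) (hT' : ∀ f ∈ Xhat, hatOp T f ∈ Xhat)
    (hS' : ∀ f ∈ Xhat, hatOp S f ∈ Xhat) : Stabilizes Xhat Δ (commSeq T S) := by
  intro f hf
  rw [tens_commSeq, hatOp_commSeq, hatOp_commSeq, hT f hf, hS f hf, hT _ (hS' f hf),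
    hS _ (hT' f hf)]
  funext n
  simp only [Pi.sub_apply, map_sub]

end Convolution

/-- The degree completion of `lie(e₀,e₁)`, i.e. the product of its homogeneous components. -/
def lieHatSub : Submodule ℚ (ℕ → V) := Submodule.pi Set.univ lieDeg

/-- The degree completion `lie(e₀,e₁)^` as a type, which carries the Lie bracket `⟨ , ⟩`. -/
def LieHat : Type := lieHatSub

namespace LieHat

instance : AddCommGroup LieHat := inferInstanceAs (AddCommGroup lieHatSub)

instance : Module ℚ LieHat := inferInstanceAs (Module ℚ lieHatSub)

/-- The homogeneous component of degree `n`. -/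
def comp (x : LieHat) (n : ℕ) : V := x.1 n

theorem comp_mem (x : LieHat) (n : ℕ) : x.comp n ∈ lieDeg n := x.2 n (Set.mem_univ n)

@[ext] theorem ext {x y : LieHat} (h : ∀ n, x.comp n = y.comp n) : x = y :=
  Subtype.ext (funext h)

def mk (x : ℕ → V) (h : ∀ n, x n ∈ lieDeg n) : LieHat := ⟨x, fun n _ => h n⟩

@[simp] theorem comp_mk (x : ℕ → V) (h : ∀ n, x n ∈ lieDeg n) : (mk x h).comp = x := rfl

@[simp] theorem comp_add (x y : LieHat) : (x + y).comp = x.comp + y.comp := rfl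
@[simp] theorem comp_zero : (0 : LieHat).comp = 0 := rfl
@[simp] theorem comp_smul (c : ℚ) (x : LieHat) : (c • x).comp = c • x.comp := rfl

/-- The Lie bracket `⟨ , ⟩` extended to the completion. -/
instance : Bracket LieHat LieHat where
  bracket x y := mk (conv ihara x.comp y.comp) fun n => by
    refine Submodule.sum_mem _ fun p hp => ?_
    rw [← Finset.HasAntidiagonal.mem_antidiagonal.1 hp]
    exact ⟨ihara_mem_lie (x.comp_mem _).1 (y.comp_mem _).1,
      ihara_mem_deg (x.comp_mem _).2 (y.comp_mem _).2⟩

theorem comp_lie (x y : LieHat) : ⁅x, y⁆.comp = conv ihara x.comp y.comp := rfl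

theorem ext' {x y : LieHat} (h : x.comp = y.comp) : x = y := Subtype.ext h

instance : LieRing LieHat where
  add_lie x y z := ext' (by simp only [comp_lie, comp_add, conv_add_left])
  lie_add x y z := ext' (by simp only [comp_lie, comp_add, conv_add_right])
  lie_self x := ext' (by
    funext n
    have h : conv ihara x.comp x.comp n = - conv ihara x.comp x.comp n := by
      conv_lhs => rw [conv, ← Finset.Nat.sum_antidiagonal_swap]
      rw [conv, ← Finset.sum_neg_distrib]
      exact Finset.sum_congr rfl fun p _ => ihara_skew _ _
    exact self_eq_neg.1 h)
  leibniz_lie x y z := ext' (by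
    simp only [comp_lie, comp_add]
    exact conv_lie ihara ihara ihara_leibniz _ _ _)

instance : LieAlgebra ℚ LieHat where
  lie_smul c x y := ext' (by simp only [comp_lie, comp_smul, conv_smul_right])

/-- The grading action: multiplication by `n` on the component of degree `n`. -/
def degMap : LieHat →ₗ[ℚ] LieHat where
  toFun x := mk (fun n => (n : ℚ) • x.comp n) fun n => Submodule.smul_mem _ _ (x.comp_mem n)
  map_add' x y := by
    apply ext'
    funext n
    exact smul_add (n : ℚ) (x.comp n) (y.comp n)
  map_smul' c x := by
    apply ext'
    funext n
    exact smul_comm (n : ℚ) c (x.comp n)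

theorem comp_degMap (x : LieHat) (n : ℕ) : (degMap x).comp n = (n : ℚ) • x.comp n := rfl

theorem degMap_lie (x y : LieHat) : degMap ⁅x, y⁆ = ⁅x, degMap y⁆ + ⁅degMap x, y⁆ := by
  apply ext'
  funext n
  rw [comp_degMap, comp_add, Pi.add_apply]
  simp only [comp_lie, conv, comp_degMap, Finset.smul_sum]
  rw [← Finset.sum_add_distrib]
  refine Finset.sum_congr rfl fun p hp => ?_
  rw [← Finset.HasAntidiagonal.mem_antidiagonal.1 hp, map_smul, map_smul, LinearMap.smul_apply,
    ← add_smul]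
  push_cast
  rw [add_comm]

/-- The grading action is a derivation of `(lie(e₀,e₁)^, ⟨ , ⟩)`. -/
def degDer : LieDerivation ℚ LieHat LieHat where
  toLinearMap := degMap
  leibniz' x y := by
    rw [degMap_lie, ← lie_skew y (degMap x), sub_neg_eq_add]

end LieHat

/-- The abelian Lie algebra `ℚ`. -/
instance instLieRingRat : LieRing ℚ := LieRing.ofAssociativeRing

/-- The action of the abelian Lie algebra `ℚ 1` on `(lie(e₀,e₁)^, ⟨ , ⟩)`, where `1` acts by the grading. -/
def degAction : ℚ →ₗ⁅ℚ⁆ LieDerivation ℚ LieHat LieHat where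
  toFun c := c • LieHat.degDer
  map_add' c d := add_smul _ _ _
  map_smul' c d := by simp [mul_smul]
  map_lie' := by
    intro c d
    rw [LieRing.of_associative_ring_bracket, mul_comm c d, sub_self, zero_smul]
    simp

/-- The Lie algebra `g^DR = ℚ 1 ⋉ (lie(e₀,e₁)^, ⟨ , ⟩)`. An element `g` is the pair
`(ν, x) = (g.right, g.left)`. -/
abbrev gDR : Type := LieAlgebra.SemiDirectSum LieHat ℚ degAction

/-- The homogeneous component of degree `n` of `(ν, θ(x))`, for `g = (ν, x)` in `g^DR`; the element `ν`
has degree `0`. -/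
def gammaComp (g : gDR) (n : ℕ) : ℚ × V := (if n = 0 then g.right else 0, theta (g.left.comp n))

theorem gammaComp_add (g g' : gDR) : gammaComp (g + g') = gammaComp g + gammaComp g' := by
  funext n
  refine Prod.ext ?_ ?_
  · simp only [gammaComp, Pi.add_apply, Prod.fst_add, LieAlgebra.SemiDirectSum.add_eq_mk]
    split_ifs <;> simp
  · simp [gammaComp, LieAlgebra.SemiDirectSum.add_eq_mk]

theorem gammaComp_smul (c : ℚ) (g : gDR) : gammaComp (c • g) = c • gammaComp g := by
  funext n
  refine Prod.ext ?_ ?_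
  · simp only [gammaComp, Pi.smul_apply, Prod.smul_fst, LieAlgebra.SemiDirectSum.smul_eq_mk]
    split_ifs <;> simp
  · simp [gammaComp, LieAlgebra.SemiDirectSum.smul_eq_mk]

theorem gammaComp_zero : gammaComp 0 = 0 := by
  simpa using gammaComp_smul 0 0

theorem gammaComp_mem (g : gDR) (n : ℕ) : (gammaComp g n).2 ∈ Vdeg n :=
  theta_mem (g.left.comp_mem n).2

theorem gammaComp_fst (g : gDR) (n : ℕ) (h : n ≠ 0) : (gammaComp g n).1 = 0 := if_neg h

theorem emBr_eq (u u' : ℚ × V) : emBr u u' =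
    (0, u.1 • der1 (1, 0) u'.2 - u'.1 • der1 (1, 0) u.2 + ihara u.2 u'.2) := by
  have h : ∀ u : ℚ × V, der1 u = u.1 • der1 (1, 0) + der1 (0, u.2) := by
    intro u
    rw [← map_smul, ← map_add]; simp
  rw [emBr, h u, h u', ihara_apply]
  simp only [LinearMap.add_apply, LinearMap.smul_apply]
  congr 1
  abel

theorem gammaComp_lie (g g' : gDR) (n : ℕ) : gammaComp ⁅g, g'⁆ n =
    ∑ p ∈ antidiagonal n, emBr (gammaComp g p.1) (gammaComp g' p.2) := by
  have hE : ∀ (h : gDR) (m : ℕ), der1 (1, 0) (theta (h.left.comp m)) =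
      (m : ℚ) • theta (h.left.comp m) := fun h m => der1_one_zero (theta_mem (h.left.comp_mem m).2)
  have hb : (⁅g, g'⁆ : gDR).left.comp n = conv ihara g.left.comp g'.left.comp n +
      g.right • (n : ℚ) • g'.left.comp n - g'.right • (n : ℚ) • g.left.comp n := rfl
  have hr : (⁅g, g'⁆ : gDR).right = 0 := by
    change g.right * g'.right - g'.right * g.right = 0
    rw [mul_comm, sub_self]
  refine Prod.ext ?_ ?_
  · rw [Prod.fst_sum]
    simp only [gammaComp, hr, ite_self, emBr, Finset.sum_const_zero]
  · rw [Prod.snd_sum]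
    simp only [emBr_eq, gammaComp, hE, hb, map_add, map_sub, map_smul, conv, map_sum]
    rw [Finset.sum_add_distrib, Finset.sum_sub_distrib]
    have h1 : ∑ p ∈ antidiagonal n, (if p.1 = 0 then g.right else 0) • (p.2 : ℚ) •
        theta (g'.left.comp p.2) = g.right • (n : ℚ) • theta (g'.left.comp n) := by
      rw [Finset.sum_eq_single (0, n)]
      · simp
      · rintro ⟨i, j⟩ hp hne
        rw [Finset.HasAntidiagonal.mem_antidiagonal] at hp
        rw [if_neg, zero_smul]
        rintro rfl
        apply hne
        simp only [zero_add] at hp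
        rw [hp]
      · intro h; exact absurd (Finset.HasAntidiagonal.mem_antidiagonal.2 (by simp)) h
    have h2 : ∑ p ∈ antidiagonal n, (if p.2 = 0 then g'.right else 0) • (p.1 : ℚ) •
        theta (g.left.comp p.1) = g'.right • (n : ℚ) • theta (g.left.comp n) := by
      rw [Finset.sum_eq_single (n, 0)]
      · simp
      · rintro ⟨i, j⟩ hp hne
        rw [Finset.HasAntidiagonal.mem_antidiagonal] at hp
        rw [if_neg, zero_smul]
        rintro rfl
        apply hne
        simp only [add_zero] at hp
        rw [hp]
      · intro h; exact absurd (Finset.HasAntidiagonal.mem_antidiagonal.2 (by simp)) h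
    have h3 : ∑ p ∈ antidiagonal n, theta (ihara (g.left.comp p.1) (g'.left.comp p.2)) =
        ∑ p ∈ antidiagonal n, ihara (theta (g.left.comp p.1)) (theta (g'.left.comp p.2)) :=
      Finset.sum_congr rfl fun p _ =>
        theta_ihara (g.left.comp_mem _).1 (g'.left.comp_mem _).1
    rw [h1, h2, h3]
    abel


/-- The subalgebra `W = ℚ ⊕ V e₁` of `V`. -/
def W : Subalgebra ℚ V where
  carrier := {a | ∃ (r : ℚ) (b : V), a = algebraMap ℚ V r + b * e1}
  mul_mem' := by
    rintro _ _ ⟨r, b, rfl⟩ ⟨r', b', rfl⟩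
    refine ⟨r * r', r • b' + r' • b + b * e1 * b', ?_⟩
    simp only [Algebra.algebraMap_eq_smul_one, add_mul, mul_add, smul_mul_assoc, mul_smul_comm,
      one_mul, mul_one, mul_smul, mul_assoc, smul_add, smul_comm r' r]
    abel
  add_mem' := by
    rintro _ _ ⟨r, b, rfl⟩ ⟨r', b', rfl⟩
    refine ⟨r + r', b + b', ?_⟩
    rw [map_add, add_mul]; abel
  algebraMap_mem' r := ⟨r, 0, by simp⟩

theorem mul_e1_mem (b : V) : b * e1 ∈ W := ⟨0, b, by simp⟩

/-- `ỹ₀ = -1` and `ỹₙ = e₀^{n-1} e₁` for `n > 0`. -/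
def ytilde : ℕ → W
  | 0 => -1
  | n + 1 => ⟨e0 ^ n * e1, mul_e1_mem _⟩

/-- The free algebra on generators indexed by `n ≥ 0`; generator `n` goes to `ỹₙ₊₁` under `FtoW`. -/
abbrev F : Type := FreeAlgebra ℚ ℕ

/-- The algebra morphism sending generator `n` to `ỹₙ₊₁`; it is bijective (`FtoW_bijective`). -/
def FtoW : F →ₐ[ℚ] W := FreeAlgebra.lift ℚ fun n => ytilde (n + 1)

/-- Auxiliary for the freeness of `W`: right multiplication by `e0` on `V = ⊕ₖ W e₀ᵏ`. -/
def actE0 : Module.End ℚ (ℕ →₀ F) := Finsupp.lmapDomain F ℚ Nat.succ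

/-- Auxiliary for the freeness of `W`: right multiplication by `e1` on `V = ⊕ₖ W e₀ᵏ`. -/
def actE1 : Module.End ℚ (ℕ →₀ F) :=
  Finsupp.lsum ℚ fun k => Finsupp.lsingle 0 ∘ₗ LinearMap.mulRight ℚ (FreeAlgebra.ι ℚ k)

/-- Auxiliary for the freeness of `W`: the right action of `V` on `V = ⊕ₖ W e₀ᵏ`. -/
def rightAct : V →ₐ[ℚ] (Module.End ℚ (ℕ →₀ F))ᵐᵒᵖ :=
  FreeAlgebra.lift ℚ ![MulOpposite.op actE0, MulOpposite.op actE1]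

/-- Auxiliary for the freeness of `W`: the right action of an element of `V`. -/
def ract (a : V) : Module.End ℚ (ℕ →₀ F) := (rightAct a).unop

theorem ract_mul (a b : V) (z : ℕ →₀ F) : ract (a * b) z = ract b (ract a z) := by
  simp [ract, Module.End.mul_apply]

theorem ract_add (a b : V) (z : ℕ →₀ F) : ract (a + b) z = ract a z + ract b z := by
  simp [ract]

theorem ract_algebraMap (r : ℚ) (z : ℕ →₀ F) : ract (algebraMap ℚ V r) z = r • z := by
  simp [ract, MulOpposite.algebraMap_apply, Module.algebraMap_end_apply]

theorem ract_e0 : ract e0 = actE0 := by simp [ract, rightAct, e0]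
theorem ract_e1 : ract e1 = actE1 := by simp [ract, rightAct, e1]

theorem actE0_single (k : ℕ) (f : F) : actE0 (Finsupp.single k f) = Finsupp.single (k + 1) f := by
  simp [actE0]

theorem actE1_single (k : ℕ) (f : F) :
    actE1 (Finsupp.single k f) = Finsupp.single 0 (f * FreeAlgebra.ι ℚ k) := by
  simp [actE1]

theorem ract_e0_pow (n : ℕ) (f : F) :
    ract (e0 ^ n) (Finsupp.single 0 f) = Finsupp.single n f := by
  induction n with
  | zero =>
    rw [pow_zero, ← map_one (algebraMap ℚ V), ract_algebraMap, one_smul]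
  | succ n ih => rw [pow_succ, ract_mul, ih, ract_e0, actE0_single]

theorem ract_FtoW (f g : F) :
    ract (FtoW f : V) (Finsupp.single 0 g) = Finsupp.single 0 (g * f) := by
  induction f using FreeAlgebra.induction generalizing g with
  | grade0 r =>
    rw [AlgHom.commutes, Subalgebra.coe_algebraMap, ract_algebraMap, Finsupp.smul_single,
      ← Algebra.commutes, Algebra.smul_def]
  | grade1 n =>
    rw [FtoW, FreeAlgebra.lift_ι_apply]
    change ract (e0 ^ n * e1) _ = _
    rw [ract_mul, ract_e0_pow, ract_e1, actE1_single]
  | mul a b ha hb => rw [map_mul, Subalgebra.coe_mul, ract_mul, ha, hb, mul_assoc]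
  | add a b ha hb => rw [map_add, Subalgebra.coe_add, ract_add, ha, hb, mul_add,
      Finsupp.single_add]

/-- Auxiliary for the freeness of `W`: the map `∑ₖ fₖ ↦ ∑ₖ fₖ e₀ᵏ`. -/
def psi : (ℕ →₀ F) →ₗ[ℚ] V :=
  Finsupp.lsum ℚ fun k => LinearMap.mulRight ℚ (e0 ^ k) ∘ₗ W.val.toLinearMap ∘ₗ FtoW.toLinearMap

theorem psi_single (k : ℕ) (f : F) : psi (Finsupp.single k f) = FtoW f * e0 ^ k := by
  simp [psi]

theorem psi_e1 (z : ℕ →₀ F) : ∃ f : F, ract e1 z = Finsupp.single 0 f ∧ psi z * e1 = FtoW f := by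
  induction z using Finsupp.induction_linear with
  | zero => exact ⟨0, by simp, by simp⟩
  | add x y hx hy =>
    obtain ⟨f, hf, hf'⟩ := hx
    obtain ⟨g, hg, hg'⟩ := hy
    exact ⟨f + g, by rw [map_add, hf, hg, Finsupp.single_add], by
      rw [map_add, add_mul, hf', hg', map_add, Subalgebra.coe_add]⟩
  | single k f =>
    refine ⟨f * FreeAlgebra.ι ℚ k, by rw [ract_e1, actE1_single], ?_⟩
    rw [psi_single, map_mul, Subalgebra.coe_mul, mul_assoc, FtoW, FreeAlgebra.lift_ι_apply]
    rfl

theorem psi_ract (a : V) (z : ℕ →₀ F) : psi (ract a z) = psi z * a := by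
  induction a using V_induction generalizing z with
  | h1 r => rw [ract_algebraMap, map_smul, ← Algebra.commutes, Algebra.smul_def]
  | he0 =>
    induction z using Finsupp.induction_linear with
    | zero => simp
    | add x y hx hy => rw [map_add, map_add, map_add, add_mul, hx, hy]
    | single k f => rw [ract_e0, actE0_single, psi_single, psi_single, pow_succ, mul_assoc]
  | he1 =>
    obtain ⟨f, hf, hf'⟩ := psi_e1 z
    rw [hf, hf', psi_single, pow_zero, mul_one]
  | hmul a b ha hb => rw [ract_mul, hb, ha, mul_assoc]
  | hadd a b ha hb => rw [ract_add, map_add, ha, hb, mul_add]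

theorem FtoW_bijective : Function.Bijective FtoW := by
  constructor
  · rw [injective_iff_map_eq_zero]
    intro f hf
    have h := ract_FtoW f 1
    rw [hf, one_mul, Subalgebra.coe_zero, ← map_zero (algebraMap ℚ V), ract_algebraMap,
      zero_smul] at h
    exact Finsupp.single_eq_zero.1 h.symm
  · rintro ⟨_, r, b, rfl⟩
    obtain ⟨f, hf, hf'⟩ := psi_e1 (ract b (Finsupp.single 0 1))
    refine ⟨algebraMap ℚ F r + f, Subtype.ext ?_⟩
    rw [psi_ract, psi_single, map_one, pow_zero, Subalgebra.coe_one, mul_one, one_mul] at hf'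
    rw [map_add, Subalgebra.coe_add, ← hf', AlgHom.commutes, Subalgebra.coe_algebraMap]

/-- `W` is freely generated by the `ỹₙ`, `n > 0`. -/
def FequivW : F ≃ₐ[ℚ] W := AlgEquiv.ofBijective FtoW FtoW_bijective

/-- The algebra harmonic coproduct: the unique algebra morphism `Δ^W : W → W ⊗ W` with
`Δ^W(ỹₙ) = - ∑_{i=0}^n ỹᵢ ⊗ ỹₙ₋ᵢ` for `n > 0` (`DeltaW_ytilde`, `DeltaW_unique`). -/
def DeltaW : W →ₐ[ℚ] W ⊗[ℚ] W :=
  (FreeAlgebra.lift ℚ fun n : ℕ =>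
    -∑ p ∈ antidiagonal (n + 1), ytilde p.1 ⊗ₜ[ℚ] ytilde p.2).comp FequivW.symm.toAlgHom

theorem DeltaW_ytilde (n : ℕ) (hn : 0 < n) :
    DeltaW (ytilde n) = -∑ p ∈ antidiagonal n, ytilde p.1 ⊗ₜ[ℚ] ytilde p.2 := by
  obtain ⟨n, rfl⟩ : ∃ m, n = m + 1 := ⟨n - 1, by omega⟩
  have h : FequivW.symm (ytilde (n + 1)) = FreeAlgebra.ι ℚ n := by
    rw [AlgEquiv.symm_apply_eq]
    change _ = FtoW _
    rw [FtoW, FreeAlgebra.lift_ι_apply]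
  change (FreeAlgebra.lift ℚ _) (FequivW.symm (ytilde (n + 1))) = _
  rw [h, FreeAlgebra.lift_ι_apply]

theorem DeltaW_unique (D : W →ₐ[ℚ] W ⊗[ℚ] W) (hD : ∀ n : ℕ, 0 < n →
    D (ytilde n) = -∑ p ∈ antidiagonal n, ytilde p.1 ⊗ₜ[ℚ] ytilde p.2) : D = DeltaW := by
  have h : D.comp FtoW = DeltaW.comp FtoW := by
    apply FreeAlgebra.hom_ext
    funext n
    simp only [Function.comp_apply, AlgHom.comp_apply, FtoW, FreeAlgebra.lift_ι_apply]
    rw [hD _ n.succ_pos, DeltaW_ytilde _ n.succ_pos]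
  apply AlgHom.ext
  intro w
  obtain ⟨f, rfl⟩ := FtoW_bijective.2 w
  exact DFunLike.congr_fun h f

/-- The left ideal `V e₀`. -/
def Ve0 : Submodule ℚ V := LinearMap.range (LinearMap.mulRight ℚ e0)

/-- `M = V / V e₀`. -/
abbrev M : Type := V ⧸ Ve0

/-- The map `w ↦ w · 1_M`; it is bijective (`WtoM_bijective`). -/
def WtoM : W →ₗ[ℚ] M := Ve0.mkQ ∘ₗ W.val.toLinearMap

theorem WtoM_bijective : Function.Bijective WtoM := by
  constructor
  · rw [injective_iff_map_eq_zero]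
    intro w hw
    obtain ⟨f, rfl⟩ := FtoW_bijective.2 w
    obtain ⟨u, hu⟩ := (Submodule.Quotient.mk_eq_zero _).1 hw
    have h := ract_FtoW f 1
    change u * e0 = (FtoW f : V) at hu
    rw [← hu, ract_mul, ract_e0, one_mul] at h
    have h0 := DFunLike.congr_fun h 0
    rw [Finsupp.single_eq_same] at h0
    have h1 : ∀ z : ℕ →₀ F, actE0 z 0 = 0 := by
      intro z
      induction z using Finsupp.induction_linear with
      | zero => simp
      | add x y hx hy => rw [map_add, Finsupp.add_apply, hx, hy, add_zero]
      | single k f => rw [actE0_single, Finsupp.single_eq_of_ne (by omega)]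
    rw [h1] at h0
    rw [← h0, map_zero]
  · intro m
    obtain ⟨a, rfl⟩ := Ve0.mkQ_surjective m
    induction a using V_right_induction with
    | h1 r => exact ⟨algebraMap ℚ W r, rfl⟩
    | he0 a _ =>
      refine ⟨0, ?_⟩
      rw [map_zero]
      exact ((Submodule.Quotient.mk_eq_zero Ve0).2 (LinearMap.mem_range.2 ⟨a, rfl⟩)).symm
    | he1 a _ => exact ⟨(⟨a * e1, mul_e1_mem a⟩ : W), rfl⟩
    | hadd a b ha hb =>
      obtain ⟨x, hx⟩ := ha
      obtain ⟨y, hy⟩ := hb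
      exact ⟨x + y, by rw [map_add, hx, hy, map_add]⟩
    | hsmul r a ha =>
      obtain ⟨x, hx⟩ := ha
      exact ⟨r • x, by rw [map_smul, hx, map_smul]⟩

/-- `M` is free of rank one over `W`, generated by `1_M`. -/
def WequivM : W ≃ₗ[ℚ] M := LinearEquiv.ofBijective WtoM WtoM_bijective

/-- The module harmonic coproduct `Δ^M : M → M ⊗ M`, given by
`Δ^M(w · 1_M) = Δ^W(w) · (1_M ⊗ 1_M)` for `w` in `W` (`DeltaM_WtoM`). -/
def DeltaM : M →ₗ[ℚ] M ⊗[ℚ] M :=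
  TensorProduct.map WtoM WtoM ∘ₗ DeltaW.toLinearMap ∘ₗ WequivM.symm.toLinearMap

theorem DeltaM_WtoM (w : W) : DeltaM (WtoM w) = TensorProduct.map WtoM WtoM (DeltaW w) := by
  have h : WequivM.symm (WtoM w) = w := WequivM.symm_apply_apply w
  simp only [DeltaM, LinearMap.comp_apply, LinearEquiv.coe_coe, h]
  rfl

theorem der1_mem_W (u : ℚ × V) {w : V} (hw : w ∈ W) : der1 u w ∈ W := by
  obtain ⟨r, b, rfl⟩ := hw
  rw [map_add, der1_algebraMap, der1_mul, der1_e1, zero_add, mul_smul_comm, ← smul_mul_assoc,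
    ← add_mul]
  exact mul_e1_mem _

/-- The restriction `der_u^{W,(1)}` of `der_u^{V,(1)}` to `W`. -/
def derW : (ℚ × V) →ₗ[ℚ] Module.End ℚ W where
  toFun u := (der1 u).restrict (p := Subalgebra.toSubmodule W) (q := Subalgebra.toSubmodule W)
    fun _ hw => der1_mem_W u hw
  map_add' u u' := by
    apply LinearMap.ext; intro w; apply Subtype.ext
    change der1 (u + u') w = der1 u w + der1 u' w
    rw [map_add, LinearMap.add_apply]
  map_smul' c u := by
    apply LinearMap.ext; intro w; apply Subtype.ext
    change der1 (c • u) w = c • der1 u w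
    rw [map_smul, LinearMap.smul_apply]

theorem coe_derW (u : ℚ × V) (w : W) : (derW u w : V) = der1 u w := rfl

theorem derW_emBr (u u' : ℚ × V) : derW (emBr u u') = derW u * derW u' - derW u' * derW u := by
  apply LinearMap.ext; intro w; apply Subtype.ext
  change der1 (emBr u u') w = der1 u (der1 u' w) - der1 u' (der1 u w)
  rw [der1_emBr]; rfl

theorem der10_mem_Ve0 (u : ℚ × V) : Ve0 ≤ Ve0.comap (der10 u) := by
  rintro _ ⟨a, rfl⟩
  refine ⟨der1 u a + u.1 • a + a * u.2, ?_⟩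
  simp only [LinearMap.mulRight_apply, der10_apply, der1_mul, der1_e0]
  simp only [add_mul, mul_add, mul_sub, smul_mul_assoc, mul_smul_comm, mul_assoc]
  abel

/-- The endomorphism `der_u^{M,(10)}` of `M` induced by `der_u^{V,(10)}`. -/
def derM : (ℚ × V) →ₗ[ℚ] Module.End ℚ M where
  toFun u := Ve0.mapQ Ve0 (der10 u) (der10_mem_Ve0 u)
  map_add' u u' := by
    apply Submodule.linearMap_qext
    ext a
    simp
  map_smul' c u := by
    apply Submodule.linearMap_qext
    ext a
    simp

theorem derM_mkQ (u : ℚ × V) (a : V) : derM u (Ve0.mkQ a) = Ve0.mkQ (der10 u a) := rfl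

theorem derM_emBr (u u' : ℚ × V) : derM (emBr u u') = derM u * derM u' - derM u' * derM u := by
  apply Submodule.linearMap_qext
  apply LinearMap.ext
  intro a
  simp only [LinearMap.comp_apply, LinearMap.sub_apply, Module.End.mul_apply, derM_mkQ, der10_emBr,
    map_sub]

/-- The degree completion of `W`: sequences of homogeneous components. -/
def What : Submodule ℚ (ℕ → W) :=
  Submodule.pi Set.univ fun n => (Vdeg n).comap W.val.toLinearMap

/-- The degree completion of `M`: sequences of homogeneous components. -/
def Mhat : Submodule ℚ (ℕ → M) := Submodule.pi Set.univ fun n => (Vdeg n).map Ve0.mkQ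

/-- The homogeneous components of the derivation `der^{W,(1)}_{(ν, θ(x))}` of the completion of `W`. -/
def opW (g : gDR) (n : ℕ) : Module.End ℚ W := derW (gammaComp g n)

/-- The homogeneous components of the endomorphism `der^{M,(10)}_{(ν, θ(x))}` of the completion of `M`. -/
def opM (g : gDR) (n : ℕ) : Module.End ℚ M := derM (gammaComp g n)

theorem opW_mem (g : gDR) : ∀ f ∈ What, hatOp (opW g) f ∈ What := by
  intro f hf n _
  change (hatOp (opW g) f n) ∈ (Vdeg n).comap W.val.toLinearMap
  rw [hatOp_apply]
  refine Submodule.sum_mem _ fun p hp => ?_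
  rw [← Finset.HasAntidiagonal.mem_antidiagonal.1 hp]
  exact der1_mem (gammaComp_mem g _) (gammaComp_fst g _) (hf p.2 (Set.mem_univ _))

theorem opM_mem (g : gDR) : ∀ f ∈ Mhat, hatOp (opM g) f ∈ Mhat := by
  intro f hf n _
  change (hatOp (opM g) f n) ∈ (Vdeg n).map Ve0.mkQ
  rw [hatOp_apply]
  refine Submodule.sum_mem _ fun p hp => ?_
  rw [← Finset.HasAntidiagonal.mem_antidiagonal.1 hp]
  obtain ⟨a, ha, ha'⟩ := hf p.2 (Set.mem_univ _)
  refine ⟨der10 (gammaComp g p.1) a, ?_, ?_⟩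
  · rw [der10_apply]
    refine add_mem (der1_mem (gammaComp_mem g _) (gammaComp_fst g _) ha) ?_
    rw [add_comm]
    exact Vdeg_mul ha (gammaComp_mem g _)
  · rw [← ha']; rfl

/-- The stabilizer Lie algebra of `Δ̂^{W,DR}`: the set of `g = (ν, x)` in `g^DR` such that
`D = der^{W,(1)}_{(ν, θ(x))}` satisfies `(D ⊗ id + id ⊗ D) ∘ Δ̂^W = Δ̂^W ∘ D`. -/
def stabW : LieSubalgebra ℚ gDR where
  carrier := {g | Stabilizes What DeltaW.toLinearMap (opW g)}
  zero_mem' := by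
    have h : opW 0 = 0 := by
      funext n
      rw [opW, gammaComp_zero]; exact map_zero _
    change Stabilizes _ _ _; rw [h]; exact Stabilizes.zero
  add_mem' := by
    intro g g' hg hg'
    have h : opW (g + g') = opW g + opW g' := by
      funext n; simp only [opW, gammaComp_add, Pi.add_apply, map_add]
    change Stabilizes _ _ _; rw [h]; exact hg.add hg'
  smul_mem' := by
    intro c g hg
    have h : opW (c • g) = c • opW g := by
      funext n; simp only [opW, gammaComp_smul, Pi.smul_apply, map_smul]
    change Stabilizes _ _ _; rw [h]; exact hg.smul c
  lie_mem' := by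
    intro g g' hg hg'
    have h : opW ⁅g, g'⁆ = commSeq (opW g) (opW g') := by
      funext n; simp only [opW, gammaComp_lie, commSeq, map_sum, derW_emBr]
    change Stabilizes _ _ (opW ⁅g, g'⁆)
    rw [h]; exact hg.comm hg' (opW_mem g) (opW_mem g')

/-- The stabilizer Lie algebra of `Δ̂^{M,DR}`: the set of `g = (ν, x)` in `g^DR` such that
`D = der^{M,(10)}_{(ν, θ(x))}` satisfies `(D ⊗ id + id ⊗ D) ∘ Δ̂^M = Δ̂^M ∘ D`. -/
def stabM : LieSubalgebra ℚ gDR where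
  carrier := {g | Stabilizes Mhat DeltaM (opM g)}
  zero_mem' := by
    have h : opM 0 = 0 := by
      funext n
      rw [opM, gammaComp_zero]; exact map_zero _
    change Stabilizes _ _ _; rw [h]; exact Stabilizes.zero
  add_mem' := by
    intro g g' hg hg'
    have h : opM (g + g') = opM g + opM g' := by
      funext n; simp only [opM, gammaComp_add, Pi.add_apply, map_add]
    change Stabilizes _ _ _; rw [h]; exact hg.add hg'
  smul_mem' := by
    intro c g hg
    have h : opM (c • g) = c • opM g := by
      funext n; simp only [opM, gammaComp_smul, Pi.smul_apply, map_smul]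
    change Stabilizes _ _ _; rw [h]; exact hg.smul c
  lie_mem' := by
    intro g g' hg hg'
    have h : opM ⁅g, g'⁆ = commSeq (opM g) (opM g') := by
      funext n; simp only [opM, gammaComp_lie, commSeq, map_sum, derM_emBr]
    change Stabilizes _ _ (opM ⁅g, g'⁆)
    rw [h]; exact hg.comm hg' (opM_mem g) (opM_mem g')

end HarmonicStab

end

noncomputable section

namespace HarmonicStab

open scoped TensorProduct
open Finset.HasAntidiagonal (antidiagonal)

/-! ### Stabilizers in terms of homogeneous components -/

/-! Both conditions can be tested one homogeneous component at a time (`stabilizes_pi_iff`). Let `u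
= (ν, v)` be such a component of `(ν, θ(x))`, let D be the derivation of W attached to it, and write
v = a + b e₀ with a in W.

Under the identification w ↦ w · 1_M of W with M, the endomorphism of M becomes w ↦ D(w) + w a.
Evaluating the M-condition at 1_M gives Δ(a) = a ⊗ 1 + 1 ⊗ a. Conversely, when a is primitive, Δ(w
a) = Δ(w)(a ⊗ 1 + 1 ⊗ a), so the extra term w a is harmless. Hence the M-condition is the
W-condition together with the primitivity of a (`derM_stab_iff`). One inclusion is then immediate,
and the content of the theorem is that the W-condition forces a to be primitive.

To see this, test the W-condition on ỹ_{2i+2} for i large. One has D(ỹ_{m+1}) = (m+1)ν ỹ_{m+1} + v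
e₀^m e₁ - e₀^m v e₁ and v e₀^m e₁ = a ỹ_{m+1} + b e₀^{m+1} e₁. Compare on both sides the left
cofactor of ỹ_{i+1} ⊗ ỹ_{i+1}, that is, the result of right division by it. On the side Δ ∘ D, the
term a ỹ_{2i+2} contributes -Δ(a). On the other side, the term -ỹ_{i+1} ⊗ ỹ_{i+1} of Δ(ỹ_{2i+2})
contributes -(a ⊗ 1 + 1 ⊗ a). All the rest is scalar: the b-terms end in a letter of too large an
index, and e₀^m v e₁ begins with so many e₀ that, for i large, only a scalar can stand to the left
of the divisor. This gives Δ(a) = a ⊗ 1 + 1 ⊗ a + c (`exists_DeltaW_eq`).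

Finally the augmentation is compatible with Δ, and it kills v because the Lie series x, hence θ(x),
has no constant term. So it kills a, and c = 0 (`DeltaW_eq_of_stab`). -/

theorem stabilizes_pi_iff {X : Type*} [AddCommGroup X] [Module ℚ X] (A : ℕ → Submodule ℚ X)
    (hA : ⨆ n, A n = ⊤) (Δ : X →ₗ[ℚ] X ⊗[ℚ] X) (T : ℕ → Module.End ℚ X) :
    Stabilizes (Submodule.pi Set.univ A) Δ T ↔ ∀ d x, tens (T d) (Δ x) = Δ (T d x) := by
  constructor
  · intro h d x
    have hx : x ∈ ⨆ n, A n := hA ▸ Submodule.mem_top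
    induction hx using Submodule.iSup_induction' with
    | mem m x hx =>
      -- Test on the sequence concentrated in degree m and read off degree d + m: only the pair (d,
      -- m) survives in the two convolution sums.
      have hf : (Pi.single m x : ℕ → X) ∈ Submodule.pi Set.univ A := by
        intro n _
        rcases eq_or_ne n m with rfl | hn
        · rwa [Pi.single_eq_same]
        · rw [Pi.single_eq_of_ne hn]; exact zero_mem _
      have key := congrFun (h _ hf) (d + m)
      simp only [hatOp_apply] at key
      have hne : ∀ p ∈ antidiagonal (d + m), p ≠ (d, m) → (Pi.single m x : ℕ → X) p.2 = 0 := by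
        rintro ⟨i, j⟩ hp hne
        rw [Finset.HasAntidiagonal.mem_antidiagonal] at hp
        refine Pi.single_eq_of_ne ?_ _
        rintro rfl
        exact hne (by simpa using hp)
      have hmem : (d, m) ∈ antidiagonal (d + m) := by simp
      rw [Finset.sum_eq_single_of_mem _ hmem fun p hp hp' => by
          rw [hne p hp hp', map_zero, map_zero],
        Finset.sum_eq_single_of_mem _ hmem fun p hp hp' => by rw [hne p hp hp', map_zero]] at key
      simpa using key
    | zero => simp
    | add x y _ _ hx hy => simp only [map_add, hx, hy]
  · intro h f _
    funext n
    simp only [hatOp_apply, map_sum, h]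

/-! ### Homogeneous elements span V, W and M. -/

theorem iSup_Vdeg : ⨆ n, Vdeg n = ⊤ := by
  rw [eq_top_iff]
  rintro b -
  induction b using V_right_induction with
  | h1 r =>
    refine Submodule.mem_iSup_of_mem 0 ?_
    rw [Vdeg, pow_zero]
    exact Submodule.mem_one.2 ⟨r, rfl⟩
  | he0 a ha =>
    induction ha using Submodule.iSup_induction' with
    | mem m x hx => exact Submodule.mem_iSup_of_mem (m + 1) (Vdeg_mul hx e0_mem)
    | zero => simp
    | add x y _ _ hx hy => rw [add_mul]; exact add_mem hx hy
  | he1 a ha =>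
    induction ha using Submodule.iSup_induction' with
    | mem m x hx => exact Submodule.mem_iSup_of_mem (m + 1) (Vdeg_mul hx e1_mem)
    | zero => simp
    | add x y _ _ hx hy => rw [add_mul]; exact add_mem hx hy
  | hadd a b ha hb => exact add_mem ha hb
  | hsmul r a ha => exact Submodule.smul_mem _ _ ha

/-- The map `b ↦ b e₁` from `V` to `W`. -/
def mulE1 : V →ₗ[ℚ] W where
  toFun b := ⟨b * e1, mul_e1_mem b⟩
  map_add' a b := Subtype.ext (add_mul a b e1)
  map_smul' c a := Subtype.ext (smul_mul_assoc c a e1)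

theorem coe_mulE1 (b : V) : (mulE1 b : V) = b * e1 := rfl

theorem mulE1_coe_mul (w : W) (b : V) : mulE1 (w * b) = w * mulE1 b :=
  Subtype.ext (mul_assoc _ _ _)

theorem mulE1_e0_pow (n : ℕ) : mulE1 (e0 ^ n) = ytilde (n + 1) := rfl

theorem exists_eq_algebraMap_add_mulE1 (w : W) : ∃ r b, w = algebraMap ℚ W r + mulE1 b := by
  obtain ⟨_, r, b, rfl⟩ := w
  exact ⟨r, b, rfl⟩

theorem iSup_Wdeg : ⨆ n, (Vdeg n).comap W.val.toLinearMap = ⊤ := by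
  rw [eq_top_iff]
  rintro w -
  obtain ⟨r, b, rfl⟩ := exists_eq_algebraMap_add_mulE1 w
  refine add_mem (Submodule.mem_iSup_of_mem 0 ?_) ?_
  · rw [Submodule.mem_comap, Vdeg, pow_zero]
    exact Submodule.mem_one.2 ⟨r, rfl⟩
  · have hb : b ∈ ⨆ n, Vdeg n := iSup_Vdeg ▸ Submodule.mem_top
    induction hb using Submodule.iSup_induction' with
    | mem m x hx =>
      exact Submodule.mem_iSup_of_mem (m + 1) (Submodule.mem_comap.2 (Vdeg_mul hx e1_mem))
    | zero => simp
    | add x y _ _ hx hy => rw [map_add]; exact add_mem hx hy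

theorem iSup_Mdeg : ⨆ n, (Vdeg n).map Ve0.mkQ = ⊤ := by
  rw [← Submodule.map_iSup, iSup_Vdeg, Submodule.map_top, Submodule.range_mkQ]

theorem mem_stabW_iff (g : gDR) :
    g ∈ stabW ↔ ∀ d w, tens (derW (gammaComp g d)) (DeltaW w) = DeltaW (derW (gammaComp g d) w) :=
  stabilizes_pi_iff _ iSup_Wdeg _ _

theorem mem_stabM_iff (g : gDR) :
    g ∈ stabM ↔ ∀ d m, tens (derM (gammaComp g d)) (DeltaM m) = DeltaM (derM (gammaComp g d) m) :=
  stabilizes_pi_iff _ iSup_Mdeg _ _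

/-! ### The module condition in terms of the algebra condition -/

/-- The element `a` is the coordinate of the class of v under W ≅ M. -/
theorem exists_eq_W_add_mul_e0 (v : V) : ∃ (a : W) (b : V), v = a + b * e0 := by
  obtain ⟨a, ha⟩ := WtoM_bijective.2 (Ve0.mkQ v)
  obtain ⟨b, hb⟩ := (Submodule.Quotient.eq Ve0).1 ha.symm
  exact ⟨a, b, by
    rw [LinearMap.mulRight_apply] at hb
    rw [hb]; exact (add_sub_cancel (a : V) v).symm⟩

theorem derW_one (u : ℚ × V) : derW u 1 = 0 :=
  Subtype.ext (by
    have h := der1_algebraMap u 1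
    rwa [map_one] at h)

/-- `der10` adds w v = w a + w b e₀ to `der1`, and w b e₀ vanishes in V / V e₀. -/
theorem derM_WtoM (u : ℚ × V) {a : W} {b : V} (h : u.2 = a + b * e0) (w : W) :
    derM u (WtoM w) = WtoM (derW u w + w * a) := by
  refine (Submodule.Quotient.eq Ve0).2 ⟨w * b, ?_⟩
  rw [LinearMap.mulRight_apply, der10_apply, h]
  change _ = der1 u w + (w : V) * (a + b * e0) - (der1 u w + (w : V) * a)
  noncomm_ring

section TensorSquare

variable {X : Type*} [AddCommGroup X] [Module ℚ X]

theorem tensor_add_right_cancel {x y z : X ⊗[ℚ] X} (h : x + z = y + z) : x = y :=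
  add_right_cancel h

theorem tensor_neg_eq_smul (x : X ⊗[ℚ] X) : -x = (-1 : ℚ) • x := (neg_one_smul ℚ x).symm

theorem tensor_eq_add_smul {x y z : X ⊗[ℚ] X} {c : ℚ}
    (h : (-1 : ℚ) • x + c • y = (-1 : ℚ) • z) : x = z + c • y := by
  rw [neg_one_smul, neg_one_smul, neg_add_eq_iff_eq_add] at h
  rw [h]
  abel

end TensorSquare

/-- The sign is kept as a scalar so that linear maps and products move past it by `map_smul` and
`mul_smul_comm`. -/
theorem DeltaW_ytilde_succ (n : ℕ) : DeltaW (ytilde (n + 1)) =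
    (-1 : ℚ) • ∑ p ∈ antidiagonal (n + 1), ytilde p.1 ⊗ₜ[ℚ] ytilde p.2 :=
  (DeltaW_ytilde _ n.succ_pos).trans (tensor_neg_eq_smul _)

theorem tens_add_mulRight (D : Module.End ℚ W) (a : W) (t : W ⊗[ℚ] W) :
    tens (D + LinearMap.mulRight ℚ a) t = tens D t + t * (a ⊗ₜ 1 + 1 ⊗ₜ a) := by
  induction t with
  | zero => simp
  | tmul p q =>
    simp [tens_apply, TensorProduct.add_tmul, TensorProduct.tmul_add, mul_add]
    abel
  | add x y hx hy =>
    rw [map_add, hx, hy, map_add, add_mul]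
    abel

/-- Everything is transported to W ⊗ W, where the endomorphism of M is D plus right multiplication
by `a`. The M-condition then differs from the W-condition by Δ(w)(a ⊗ 1 + 1 ⊗ a) on one side and
Δ(w)Δ(a) on the other. -/
theorem derM_stab_iff (u : ℚ × V) {a : W} {b : V} (h : u.2 = a + b * e0) :
    (∀ m, tens (derM u) (DeltaM m) = DeltaM (derM u m)) ↔
      (∀ w, tens (derW u) (DeltaW w) = DeltaW (derW u w)) ∧
        DeltaW a = a ⊗ₜ 1 + 1 ⊗ₜ a := by
  have hinj : Function.Injective (TensorProduct.map WtoM WtoM) :=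
    (TensorProduct.congr WequivM WequivM).injective
  have htens : ∀ t : W ⊗[ℚ] W, tens (derM u) (TensorProduct.map WtoM WtoM t) =
      TensorProduct.map WtoM WtoM (tens (derW u + LinearMap.mulRight ℚ a) t) := by
    intro t
    induction t with
    | zero => simp
    | tmul p q => simp [tens_apply, derM_WtoM u h]
    | add x y hx hy => simp only [map_add, hx, hy]
  have key : (∀ m, tens (derM u) (DeltaM m) = DeltaM (derM u m)) ↔
      ∀ w, tens (derW u) (DeltaW w) + DeltaW w * (a ⊗ₜ 1 + 1 ⊗ₜ a) =
        DeltaW (derW u w) + DeltaW w * DeltaW a := by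
    rw [WtoM_bijective.2.forall]
    refine forall_congr' fun w => ?_
    rw [DeltaM_WtoM, htens, derM_WtoM u h, DeltaM_WtoM, hinj.eq_iff, tens_add_mulRight, map_add,
      map_mul]
  rw [key]
  constructor
  · intro H
    -- At w = 1 the derivation contributes nothing, which leaves exactly the primitivity of `a`.
    have h1 := H 1
    have ha : DeltaW a = a ⊗ₜ 1 + 1 ⊗ₜ a := by
      rw [derW_one, map_one, map_zero, one_mul, one_mul, zero_add,
        Algebra.TensorProduct.one_def, tens_apply] at h1
      simpa [derW_one] using h1.symm
    refine ⟨fun w => ?_, ha⟩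
    have hw := H w
    rw [ha] at hw
    exact tensor_add_right_cancel hw
  · rintro ⟨H, ha⟩ w
    rw [H, ha]

/-! ### Right division by a generator of `W` -/

theorem W_induction {p : W → Prop} (h1 : ∀ r : ℚ, p (algebraMap ℚ W r))
    (hy : ∀ n, p (ytilde (n + 1))) (hmul : ∀ a b, p a → p b → p (a * b))
    (hadd : ∀ a b, p a → p b → p (a + b)) (w : W) : p w := by
  obtain ⟨f, rfl⟩ := FtoW_bijective.2 w
  induction f using FreeAlgebra.induction with
  | grade0 r => rw [AlgHom.commutes]; exact h1 r
  | grade1 n => rw [FtoW, FreeAlgebra.lift_ι_apply]; exact hy n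
  | mul a b ha hb => rw [map_mul]; exact hmul _ _ ha hb
  | add a b ha hb => rw [map_add]; exact hadd _ _ ha hb

/-- The augmentation of `V`, sending `e0` and `e1` to `0`. -/
def augV : V →ₐ[ℚ] ℚ := FreeAlgebra.lift ℚ fun _ => 0

theorem augV_e0 : augV e0 = 0 := by simp [augV, e0]
theorem augV_e1 : augV e1 = 0 := by simp [augV, e1]

/-- The augmentation of `W`. -/
def augW : W →ₐ[ℚ] ℚ := augV.comp W.val

theorem augW_mulE1 (b : V) : augW (mulE1 b) = 0 := by
  change augV (b * e1) = 0
  rw [map_mul, augV_e1, mul_zero]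

theorem augW_ytilde (n : ℕ) : augW (ytilde n) = if n = 0 then -1 else 0 := by
  cases n with
  | zero => simp [ytilde]
  | succ n => rw [← mulE1_e0_pow, augW_mulE1, if_neg n.succ_ne_zero]

/-- Auxiliary for `rdiv`: the algebra morphism
`w ↦ !![w, rdiv i w; 0, augW w]`. -/
def rdivMatrix (i : ℕ) : W →ₐ[ℚ] Matrix (Fin 2) (Fin 2) W :=
  (FreeAlgebra.lift ℚ fun n : ℕ =>
    !![ytilde (n + 1), if n = i then 1 else 0; 0, 0]).comp FequivW.symm.toAlgHom

theorem rdivMatrix_ytilde (i n : ℕ) : rdivMatrix i (ytilde (n + 1)) =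
    !![ytilde (n + 1), if n = i then 1 else 0; 0, 0] := by
  have h : FequivW.symm (ytilde (n + 1)) = FreeAlgebra.ι ℚ n := by
    rw [AlgEquiv.symm_apply_eq]
    change _ = FtoW _
    rw [FtoW, FreeAlgebra.lift_ι_apply]
  change (FreeAlgebra.lift ℚ _) (FequivW.symm (ytilde (n + 1))) = _
  rw [h, FreeAlgebra.lift_ι_apply]

/-- Right division by `ỹᵢ₊₁`: the linear endomorphism of `W` with `w ỹᵢ₊₁ ↦ w`, `w ỹⱼ₊₁ ↦ 0` for
`j ≠ i`, and `1 ↦ 0`. -/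
def rdiv (i : ℕ) : Module.End ℚ W :=
  Matrix.entryLinearMap ℚ W 0 1 ∘ₗ (rdivMatrix i).toLinearMap

/-- The upper right entry is the definition of `rdiv`; the other three are checked on generators,
since upper triangular matrices multiply entrywise along the diagonal. -/
theorem rdivMatrix_eq (i : ℕ) (w : W) :
    rdivMatrix i w = !![w, rdiv i w; 0, algebraMap ℚ W (augW w)] := by
  have h : rdivMatrix i w 0 0 = w ∧ rdivMatrix i w 1 0 = 0 ∧
      rdivMatrix i w 1 1 = algebraMap ℚ W (augW w) := by
    induction w using W_induction with
    | h1 r => simp [Matrix.algebraMap_matrix_apply]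
    | hy n => simp [rdivMatrix_ytilde, augW_ytilde]
    | hmul a b ha hb => simp [Matrix.mul_apply, Fin.sum_univ_two, ha, hb]
    | hadd a b ha hb => simp [ha, hb]
  refine Matrix.ext fun k l => ?_
  fin_cases k <;> fin_cases l
  exacts [h.1, rfl, h.2.1, h.2.2]

/-- A Fox-type Leibniz rule, read off from the upper right entry of a product of triangular
matrices. The last letter of ab is that of b, unless b is a constant. -/
theorem rdiv_mul (i : ℕ) (a b : W) : rdiv i (a * b) = a * rdiv i b + augW b • rdiv i a := by
  change rdivMatrix i (a * b) 0 1 = _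
  rw [map_mul, Matrix.mul_apply, Fin.sum_univ_two, rdivMatrix_eq, rdivMatrix_eq]
  simp [Algebra.smul_def, Algebra.commutes]

theorem rdiv_algebraMap (i : ℕ) (r : ℚ) : rdiv i (algebraMap ℚ W r) = 0 := by
  change rdivMatrix i (algebraMap ℚ W r) 0 1 = 0
  simp [Matrix.algebraMap_matrix_apply]

theorem rdiv_ytilde (i n : ℕ) : rdiv i (ytilde n) = if n = i + 1 then 1 else 0 := by
  cases n with
  | zero =>
    have : ytilde 0 = algebraMap ℚ W (-1) := by simp [ytilde]
    rw [this, rdiv_algebraMap, if_neg (by omega)]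
  | succ n =>
    change rdivMatrix i _ 0 1 = _
    rw [rdivMatrix_ytilde]
    simp

/-- Only finitely many of the free generators occur in a given element. -/
theorem eventually_rdiv_eq_zero (w : W) : ∀ᶠ i in Filter.atTop, rdiv i w = 0 := by
  induction w using W_induction with
  | h1 r => exact Filter.Eventually.of_forall fun i => rdiv_algebraMap i r
  | hy n =>
    filter_upwards [Filter.eventually_gt_atTop n] with i hi
    rw [rdiv_ytilde, if_neg (by omega)]
  | hmul a b ha hb =>
    filter_upwards [ha, hb] with i ha hb
    rw [rdiv_mul, ha, hb, mul_zero, smul_zero, add_zero]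
  | hadd a b ha hb =>
    filter_upwards [ha, hb] with i ha hb
    rw [map_add, ha, hb, add_zero]

/-! ### Augmentation and right division on W ⊗ W. -/

/-- The augmentation of `W ⊗ W`. -/
def augWW : W ⊗[ℚ] W →ₐ[ℚ] ℚ := Algebra.TensorProduct.lift augW augW fun _ _ => Commute.all _ _

theorem augWW_tmul (a b : W) : augWW (a ⊗ₜ b) = augW a * augW b := by simp [augWW]

/-- Both sides are algebra morphisms. In Δ(ỹₙ) with n > 0, each term has a factor of positive index,
which the augmentation kills. -/
theorem augWW_DeltaW (w : W) : augWW (DeltaW w) = augW w := by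
  induction w using W_induction with
  | h1 r => rw [AlgHom.commutes, AlgHom.commutes, AlgHom.commutes]
  | hy n =>
    rw [DeltaW_ytilde_succ, map_smul, map_sum, augW_ytilde, if_neg n.succ_ne_zero,
      Finset.sum_eq_zero, smul_zero]
    rintro ⟨i, j⟩ h
    rw [Finset.HasAntidiagonal.mem_antidiagonal] at h
    rw [augWW_tmul, augW_ytilde, augW_ytilde]
    dsimp only at h ⊢
    split_ifs
    · omega
    all_goals simp
  | hmul a b ha hb => rw [map_mul, map_mul, map_mul, ha, hb]
  | hadd a b ha hb => rw [map_add, map_add, map_add, ha, hb]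

/-- Right division by `ỹᵢ₊₁ ⊗ ỹⱼ₊₁`. -/
def rdiv₂ (i j : ℕ) : Module.End ℚ (W ⊗[ℚ] W) := TensorProduct.map (rdiv i) (rdiv j)

theorem rdiv₂_tmul (i j : ℕ) (a b : W) : rdiv₂ i j (a ⊗ₜ b) = rdiv i a ⊗ₜ rdiv j b := rfl

/-- Since m is large, the only term of Δ(ỹ_{m+1}) that can contribute is -ỹ_{i+1} ⊗ ỹ_{j+1}, which
occurs exactly when the indices add up to m + 1. -/
theorem rdiv₂_mul_DeltaW_ytilde (i j m : ℕ) (hm : i + j + 1 ≤ m) (t : W ⊗[ℚ] W) :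
    rdiv₂ i j (t * DeltaW (ytilde (m + 1))) = if m = i + j + 1 then (-1 : ℚ) • t else 0 := by
  induction t with
  | zero => simp
  | add x y hx hy =>
    rw [add_mul, map_add, hx, hy]
    split_ifs
    · rw [smul_add]
    · rw [add_zero]
  | tmul p q =>
    have hterm : ∀ k ∈ antidiagonal (m + 1), rdiv₂ i j (p ⊗ₜ q * ytilde k.1 ⊗ₜ ytilde k.2) =
        if k = (i + 1, j + 1) then p ⊗ₜ[ℚ] q else 0 := by
      rintro ⟨k, l⟩ hk
      rw [Finset.HasAntidiagonal.mem_antidiagonal] at hk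
      rw [Algebra.TensorProduct.tmul_mul_tmul, rdiv₂_tmul, rdiv_mul, rdiv_mul, rdiv_ytilde,
        rdiv_ytilde, augW_ytilde, augW_ytilde]
      simp only [Prod.mk.injEq] at hk ⊢
      by_cases h1 : k = i + 1
      · by_cases h2 : l = j + 1
        · simp [h1, h2]
        · have : l ≠ 0 := by omega
          simp [h2, this]
      -- For k = 0 the left factor is multiplied by the scalar ỹ₀ = -1, so its quotient may survive.
      -- The right factor then ends in ỹ_{m+1} with m > j and has quotient zero.
      · by_cases h0 : k = 0
        · have h3 : l ≠ 0 := by omega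
          have h4 : l ≠ j + 1 := by omega
          simp [h1, h3, h4]
        · simp [h1, h0]
    rw [DeltaW_ytilde_succ, mul_smul_comm, map_smul, Finset.mul_sum, map_sum,
      Finset.sum_congr rfl hterm, Finset.sum_ite_eq']
    by_cases h : m = i + j + 1
    · rw [if_pos h, if_pos (by rw [Finset.HasAntidiagonal.mem_antidiagonal]; dsimp only; omega)]
    · rw [if_neg h, if_neg (by rw [Finset.HasAntidiagonal.mem_antidiagonal]; dsimp only; omega),
        smul_zero]

/-- Once i and j exceed the indices of all letters in t, the divisor can only be the left factor ỹ_k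
⊗ ỹ_l itself, multiplied by the constant term of t. -/
theorem exists_rdiv₂_tmul_mul (t : W ⊗[ℚ] W) : ∃ N, ∀ i ≥ N, ∀ j ≥ N, ∀ k l,
    rdiv₂ i j (ytilde k ⊗ₜ ytilde l * t) = if k = i + 1 ∧ l = j + 1 then augWW t • 1 else 0 := by
  induction t with
  | zero => exact ⟨0, by simp⟩
  | add x y hx hy =>
    obtain ⟨N, hN⟩ := hx
    obtain ⟨N', hN'⟩ := hy
    refine ⟨max N N', fun i hi j hj k l => ?_⟩
    rw [mul_add, map_add, hN i (le_of_max_le_left hi) j (le_of_max_le_left hj),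
      hN' i (le_of_max_le_right hi) j (le_of_max_le_right hj), map_add, add_smul]
    split_ifs <;> simp
  | tmul p q =>
    obtain ⟨N, hN⟩ := Filter.eventually_atTop.1
      ((eventually_rdiv_eq_zero p).and (eventually_rdiv_eq_zero q))
    refine ⟨N, fun i hi j hj k l => ?_⟩
    rw [Algebra.TensorProduct.tmul_mul_tmul, rdiv₂_tmul, rdiv_mul, rdiv_mul, (hN i hi).1,
      (hN j hj).2, rdiv_ytilde, rdiv_ytilde, augWW_tmul]
    by_cases h1 : k = i + 1 <;> by_cases h2 : l = j + 1 <;>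
      simp [h1, h2, TensorProduct.smul_tmul', smul_smul, mul_comm,
        Algebra.TensorProduct.one_def]

/-- The bound N is uniform in m, which is essential because m = i + j + 1 + s will grow with i and
j. -/
theorem exists_rdiv₂_DeltaW_ytilde_mul (t : W ⊗[ℚ] W) : ∃ N, ∀ i ≥ N, ∀ j ≥ N, ∀ m,
    rdiv₂ i j (DeltaW (ytilde (m + 1)) * t) =
      if m = i + j + 1 then (-augWW t) • 1 else 0 := by
  obtain ⟨N, hN⟩ := exists_rdiv₂_tmul_mul t
  refine ⟨N, fun i hi j hj m => ?_⟩
  have hterm : ∀ k ∈ antidiagonal (m + 1), rdiv₂ i j (ytilde k.1 ⊗ₜ ytilde k.2 * t) =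
      if k = (i + 1, j + 1) then augWW t • (1 : W ⊗[ℚ] W) else 0 := by
    intro k _
    rw [hN i hi j hj]
    exact if_congr (Prod.ext_iff (x := k) (y := (i + 1, j + 1))).symm rfl rfl
  rw [DeltaW_ytilde_succ, smul_mul_assoc, map_smul, Finset.sum_mul, map_sum,
    Finset.sum_congr rfl hterm, Finset.sum_ite_eq']
  by_cases h : m = i + j + 1
  · rw [if_pos h, if_pos (by rw [Finset.HasAntidiagonal.mem_antidiagonal]; dsimp only; omega),
      smul_smul, neg_one_mul]
  · rw [if_neg h, if_neg (by rw [Finset.HasAntidiagonal.mem_antidiagonal]; dsimp only; omega),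
      smul_zero]

/-! ### The leading terms of the derivation -/

theorem V_left_induction {p : V → Prop} (h1 : ∀ r : ℚ, p (algebraMap ℚ V r))
    (he0 : ∀ a, p a → p (e0 * a)) (he1 : ∀ a, p a → p (e1 * a))
    (hadd : ∀ a b, p a → p b → p (a + b)) (hsmul : ∀ (r : ℚ) a, p a → p (r • a)) (a : V) :
    p a := by
  have : ∀ a b : V, p b → p (a * b) := by
    intro a
    induction a using V_induction with
    | h1 r => intro b hb; rw [← Algebra.smul_def]; exact hsmul _ _ hb
    | he0 => exact he0
    | he1 => exact he1
    | hmul a b ha hb => intro c hc; rw [mul_assoc]; exact ha _ (hb _ hc)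
    | hadd a b ha hb => intro c hc; rw [add_mul]; exact hadd _ _ (ha _ hc) (hb _ hc)
  have h := this a 1 (by simpa using h1 1)
  rwa [mul_one] at h

theorem mulE1_mul_e1_mul_e0_pow (b : V) (m : ℕ) :
    mulE1 (b * e1 * e0 ^ m) = mulE1 b * ytilde (m + 1) := by
  rw [← coe_mulE1, mulE1_coe_mul, mulE1_e0_pow]

theorem mulE1_e0_pow_mul_e1_mul (b : V) (m : ℕ) :
    mulE1 (e0 ^ m * (e1 * b)) = ytilde (m + 1) * mulE1 b := by
  rw [← mulE1_coe_mul]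
  congr 1
  exact (mul_assoc _ _ _).symm

/-- Every word of b e₀^m e₁ ends in a letter ỹ_k with k ≥ m + 1 > i + 1. -/
theorem rdiv_mulE1_mul_e0_pow (i m : ℕ) (hm : i < m) (b : V) :
    rdiv i (mulE1 (b * e0 ^ m)) = 0 := by
  induction b using V_right_induction generalizing m with
  | h1 r =>
    rw [← Algebra.smul_def, map_smul, mulE1_e0_pow, map_smul, rdiv_ytilde, if_neg (by omega),
      smul_zero]
  | he0 a ih => rw [mul_assoc, ← pow_succ']; exact ih _ (by omega)
  | he1 a _ =>
    rw [mulE1_mul_e1_mul_e0_pow, rdiv_mul, rdiv_ytilde, augW_ytilde, if_neg (by omega),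
      if_neg (by omega), mul_zero, zero_smul, add_zero]
  | hadd a b ha hb => rw [add_mul, map_add, map_add, ha m hm, hb m hm, add_zero]
  | hsmul r a ha => rw [smul_mul_assoc, map_smul, map_smul, ha m hm, smul_zero]

/-- Here the last letter ỹ_k has k ≥ m + 1 > (i + 1) + (j + 1), so its coproduct contains no ỹ_{i+1}
⊗ ỹ_{j+1}. -/
theorem rdiv₂_DeltaW_mulE1_mul_e0_pow (i j m : ℕ) (hm : i + j + 1 < m) (b : V) :
    rdiv₂ i j (DeltaW (mulE1 (b * e0 ^ m))) = 0 := by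
  have key : ∀ (t : W ⊗[ℚ] W) m, i + j + 1 < m → rdiv₂ i j (t * DeltaW (ytilde (m + 1))) = 0 :=
    fun t m hm => by rw [rdiv₂_mul_DeltaW_ytilde _ _ _ hm.le, if_neg hm.ne']
  induction b using V_right_induction generalizing m with
  | h1 r =>
    rw [← Algebra.smul_def, map_smul, mulE1_e0_pow, map_smul, map_smul, ← one_mul (DeltaW _),
      key 1 m hm, smul_zero]
  | he0 a ih => rw [mul_assoc, ← pow_succ']; exact ih _ (by omega)
  | he1 a _ => rw [mulE1_mul_e1_mul_e0_pow, map_mul, key _ m hm]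
  | hadd a b ha hb => rw [add_mul, map_add, map_add, map_add, ha m hm, hb m hm, add_zero]
  | hsmul r a ha => rw [smul_mul_assoc, map_smul, map_smul, map_smul, ha m hm, smul_zero]

/-- The first letter of e₀^{i+s} b e₁ has index at least i + s + 1. If the word has further letters,
they come from b e₁ and have bounded index, so for i large none of them is ỹ_{i+1}; a quotient
arises only from a single-letter word and is scalar. The shift s absorbs the e₀ at the start of b
during the induction; the case used later is s = 0. -/
theorem exists_rdiv_mulE1_e0_pow_mul (b : V) (s : ℕ) : ∃ (N : ℕ) (c : ℚ), ∀ i ≥ N,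
    rdiv i (mulE1 (e0 ^ (i + s) * b)) = c • 1 := by
  induction b using V_left_induction generalizing s with
  | h1 r =>
    refine ⟨0, if s = 0 then r else 0, fun i _ => ?_⟩
    rw [← Algebra.commutes, ← Algebra.smul_def, map_smul, mulE1_e0_pow, map_smul, rdiv_ytilde]
    by_cases h : s = 0 <;> simp [h]
  | he0 a ih =>
    obtain ⟨N, c, h⟩ := ih (s + 1)
    refine ⟨N, c, fun i hi => ?_⟩
    rw [← mul_assoc, ← pow_succ]
    exact h i hi
  | he1 a _ =>
    obtain ⟨N, hN⟩ := Filter.eventually_atTop.1 (eventually_rdiv_eq_zero (mulE1 a))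
    -- The tail is a e₁: it has no constant term and, for i ≥ N, no quotient by ỹ_{i+1}.
    refine ⟨N, 0, fun i hi => ?_⟩
    rw [mulE1_e0_pow_mul_e1_mul, rdiv_mul, hN i hi, augW_mulE1]
    simp
  | hadd a b ha hb =>
    obtain ⟨N, c, h⟩ := ha s
    obtain ⟨N', c', h'⟩ := hb s
    refine ⟨max N N', c + c', fun i hi => ?_⟩
    rw [mul_add, map_add, map_add, h i (le_of_max_le_left hi), h' i (le_of_max_le_right hi),
      add_smul]
  | hsmul r a ha =>
    obtain ⟨N, c, h⟩ := ha s
    refine ⟨N, r * c, fun i hi => ?_⟩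
    rw [mul_smul_comm, map_smul, map_smul, h i hi, mul_smul]

/-- Same mechanism after Δ: the first letter gives the factor Δ(ỹ_{i+j+s+2}), and the fixed factor
to its right has no letters of index as large as i or j, so it contributes only its constant term.
-/
theorem exists_rdiv₂_DeltaW_mulE1_e0_pow_mul (b : V) (s : ℕ) :
    ∃ (N : ℕ) (c : ℚ), ∀ i ≥ N, ∀ j ≥ N,
    rdiv₂ i j (DeltaW (mulE1 (e0 ^ (i + j + 1 + s) * b))) = c • 1 := by
  have key : ∀ (s : ℕ) (t : W ⊗[ℚ] W), ∃ (N : ℕ) (c : ℚ), ∀ i ≥ N, ∀ j ≥ N,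
      rdiv₂ i j (DeltaW (ytilde (i + j + 1 + s + 1)) * t) = c • 1 := by
    intro s t
    obtain ⟨N, hN⟩ := exists_rdiv₂_DeltaW_ytilde_mul t
    refine ⟨N, if s = 0 then -augWW t else 0, fun i hi j hj => ?_⟩
    rw [hN i hi j hj]
    by_cases h : s = 0 <;> simp [h]
  induction b using V_left_induction generalizing s with
  | h1 r =>
    obtain ⟨N, c, h⟩ := key s 1
    refine ⟨N, r * c, fun i hi j hj => ?_⟩
    rw [← Algebra.commutes, ← Algebra.smul_def, map_smul, mulE1_e0_pow, map_smul, map_smul,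
      ← mul_one (DeltaW _), h i hi j hj, mul_smul]
  | he0 a ih =>
    obtain ⟨N, c, h⟩ := ih (s + 1)
    refine ⟨N, c, fun i hi j hj => ?_⟩
    rw [← mul_assoc, ← pow_succ]
    exact h i hi j hj
  | he1 a _ =>
    obtain ⟨N, c, h⟩ := key s (DeltaW (mulE1 a))
    refine ⟨N, c, fun i hi j hj => ?_⟩
    rw [mulE1_e0_pow_mul_e1_mul, map_mul, h i hi j hj]
  | hadd a b ha hb =>
    obtain ⟨N, c, h⟩ := ha s
    obtain ⟨N', c', h'⟩ := hb s
    refine ⟨max N N', c + c', fun i hi j hj => ?_⟩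
    rw [mul_add, map_add, map_add, map_add, h i (le_of_max_le_left hi) j (le_of_max_le_left hj),
      h' i (le_of_max_le_right hi) j (le_of_max_le_right hj), add_smul]
  | hsmul r a ha =>
    obtain ⟨N, c, h⟩ := ha s
    refine ⟨N, r * c, fun i hi j hj => ?_⟩
    rw [mul_smul_comm, map_smul, map_smul, map_smul, h i hi j hj, mul_smul]

/-! ### The derivation on the generators ỹₙ and comparison of leading terms. -/

/-- On powers of e₀ the derivation agrees with ν times the degree plus the commutator with v. -/
theorem der1_e0_pow (u : ℚ × V) (m : ℕ) :
    der1 u (e0 ^ m) = (m * u.1) • e0 ^ m + (u.2 * e0 ^ m - e0 ^ m * u.2) := by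
  induction m with
  | zero =>
    rw [pow_zero, ← map_one (algebraMap ℚ V), der1_algebraMap, map_one]
    simp
  | succ m ih =>
    rw [pow_succ, der1_mul, ih, der1_e0]
    push_cast
    simp only [add_mul, sub_mul, mul_add, mul_sub, smul_mul_assoc, mul_smul_comm, one_mul,
      add_smul, mul_assoc]
    abel

theorem derW_ytilde (u : ℚ × V) (m : ℕ) : derW u (ytilde (m + 1)) =
    ((m + 1) * u.1) • ytilde (m + 1) + (mulE1 (u.2 * e0 ^ m) - mulE1 (e0 ^ m * u.2)) := by
  apply Subtype.ext
  change der1 u (e0 ^ m * e1) = ((m + 1) * u.1) • (e0 ^ m * e1) +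
    (u.2 * e0 ^ m * e1 - e0 ^ m * u.2 * e1)
  rw [der1_mul, der1_e0_pow, der1_e1]
  simp only [add_mul, sub_mul, smul_mul_assoc, mul_smul_comm, add_smul, one_mul]
  abel

/-- If the derivation of `W` attached to `(ν, v)` is compatible with `Δ^W`, then the class of `v` in
`M = W · 1_M` is primitive up to a scalar. -/
theorem exists_DeltaW_eq (u : ℚ × V) {a : W} {b : V} (hu : u.2 = a + b * e0)
    (H : ∀ w, tens (derW u) (DeltaW w) = DeltaW (derW u w)) :
    ∃ c : ℚ, DeltaW a = a ⊗ₜ 1 + 1 ⊗ₜ a + c • 1 := by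
  obtain ⟨N, c, hN⟩ := exists_rdiv_mulE1_e0_pow_mul u.2 0
  obtain ⟨N', c', hN'⟩ := exists_rdiv₂_DeltaW_mulE1_e0_pow_mul u.2 0
  -- One index serves both factors: the test element is ỹ_{2i+2} and the divisor is ỹ_{i+1} ⊗
  -- ỹ_{i+1}.
  set i := max N N' with hi
  have hiN : N ≤ i := le_max_left _ _
  have hiN' : N' ≤ i := le_max_right _ _
  have hsplit : ∀ m, mulE1 (u.2 * e0 ^ m) = a * ytilde (m + 1) + mulE1 (b * e0 ^ (m + 1)) := by
    intro m
    rw [hu, add_mul, map_add, mulE1_coe_mul, mulE1_e0_pow, mul_assoc, ← pow_succ']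
  -- Dividing D(ỹ_{i+1}) by ỹ_{i+1} recovers `a` up to a scalar.
  have h1 : rdiv i (derW u (ytilde (i + 1))) = a + ((i + 1) * u.1 - c) • 1 := by
    have := hN i hiN
    rw [add_zero] at this
    rw [derW_ytilde, map_add, map_sub, this, hsplit, map_add, rdiv_mulE1_mul_e0_pow _ _ (by omega),
      rdiv_mul, map_smul, rdiv_ytilde, augW_ytilde, if_pos rfl, if_neg (by omega), sub_smul]
    simp only [mul_one, zero_smul, add_zero]
    abel
  have hy : rdiv₂ i i (DeltaW (ytilde (i + i + 1 + 1))) = (-1 : ℚ) • 1 := by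
    rw [← one_mul (DeltaW _), rdiv₂_mul_DeltaW_ytilde _ _ _ le_rfl, if_pos rfl]
  -- The side Δ ∘ D: the summand a ỹ_{2i+2} yields -Δ(a), and the others yield scalars or zero.
  have h2 : rdiv₂ i i (DeltaW (derW u (ytilde (i + i + 1 + 1)))) =
      (-1 : ℚ) • DeltaW a + (-(((i + i + 1 : ℕ) + 1) * u.1 + c')) • 1 := by
    have := hN' i hiN' i hiN'
    rw [add_zero] at this
    rw [derW_ytilde, sub_eq_add_neg, ← neg_one_smul ℚ, map_add, map_add, map_add, map_add,
      map_smul DeltaW (-1 : ℚ), map_smul (rdiv₂ i i) (-1 : ℚ), this, hsplit, map_add, map_add,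
      rdiv₂_DeltaW_mulE1_mul_e0_pow _ _ _ (by omega), map_mul,
      rdiv₂_mul_DeltaW_ytilde _ _ _ le_rfl, if_pos rfl, map_smul, map_smul, hy, add_zero]
    module
  -- The side (D ⊗ id + id ⊗ D) ∘ Δ: in each summand one tensor factor is an untouched ỹ_k, which
  -- must be ỹ_{i+1}. Since the indices add up to 2i + 2, the other factor comes from ỹ_{i+1} as
  -- well.
  have h3 : rdiv₂ i i (tens (derW u) (DeltaW (ytilde (i + i + 1 + 1)))) =
      (-1 : ℚ) • (rdiv i (derW u (ytilde (i + 1))) ⊗ₜ 1 + 1 ⊗ₜ rdiv i (derW u (ytilde (i + 1)))) := by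
    rw [DeltaW_ytilde_succ, map_smul, map_smul, map_sum, map_sum,
      Finset.sum_eq_single_of_mem (i + 1, i + 1)]
    · simp [tens_apply, rdiv₂_tmul, rdiv_ytilde]
    · rw [Finset.HasAntidiagonal.mem_antidiagonal]; dsimp only; omega
    · rintro ⟨k, l⟩ hk hne
      rw [Finset.HasAntidiagonal.mem_antidiagonal] at hk
      dsimp only at hk
      have hk1 : k ≠ i + 1 := by rintro rfl; exact hne (Prod.ext rfl (by dsimp only; omega))
      have hl1 : l ≠ i + 1 := by rintro rfl; exact hne (Prod.ext (by dsimp only; omega) rfl)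
      simp [tens_apply, rdiv₂_tmul, rdiv_ytilde, hk1, hl1]
  rw [H, h2, h1] at h3
  -- The scalars of `h1` (once for each tensor factor) and of `h2`. The ν-terms cancel, so the value
  -- is -2c - c'.
  refine ⟨2 * ((i + 1) * u.1 - c) + -(((i + i + 1 : ℕ) + 1) * u.1 + c'), ?_⟩
  rw [tensor_eq_add_smul h3, TensorProduct.add_tmul, TensorProduct.tmul_add,
    ← TensorProduct.smul_tmul', TensorProduct.tmul_smul, ← Algebra.TensorProduct.one_def]
  module

/-! ### Vanishing of the remaining constant. -/

theorem augV_lie {x : V} (hx : x ∈ lieAlg) : augV x = 0 := by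
  refine lie_induction (p := fun x => augV x = 0) augV_e0 augV_e1 (map_zero _) ?_ ?_ ?_ hx
  · intro x y hx hy; rw [map_add, hx, hy, add_zero]
  · intro c x hx; rw [map_smul, hx, smul_zero]
  · intro x y hx hy; rw [map_sub, map_mul, map_mul, hx, hy]; simp

/-- The corrections in θ are multiples of e₀ and of positive powers of e₁. -/
theorem augV_theta (x : V) : augV (theta x) = augV x := by
  change augV (x - coeff (FreeMonoid.of 0) x • e0 +
    ∑ᶠ n : ℕ, (1 / ((n : ℚ) + 1) * coeff (wordY n) x) • e1 ^ (n + 1)) = _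
  have h : augV (∑ᶠ n : ℕ, (1 / ((n : ℚ) + 1) * coeff (wordY n) x) • e1 ^ (n + 1)) = 0 := by
    refine finsum_induction (p := fun y => augV y = 0) (map_zero _)
      (fun a b ha hb => by rw [map_add, ha, hb, add_zero]) fun n => ?_
    rw [map_smul, map_pow, augV_e1, zero_pow n.succ_ne_zero, smul_zero]
  rw [map_add, h, map_sub, map_smul, augV_e0, smul_zero, sub_zero, add_zero]

/-- Applying the augmentation to Δ(a) = a ⊗ 1 + 1 ⊗ a + c leaves 0 = c, because `a` has the same
constant term as v, namely zero. -/
theorem DeltaW_eq_of_stab (u : ℚ × V) {a : W} {b : V} (hu : u.2 = a + b * e0)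
    (hu' : augV u.2 = 0) (H : ∀ w, tens (derW u) (DeltaW w) = DeltaW (derW u w)) :
    DeltaW a = a ⊗ₜ 1 + 1 ⊗ₜ a := by
  obtain ⟨c, hc⟩ := exists_DeltaW_eq u hu H
  have ha : augW a = 0 := by
    rw [hu, map_add, map_mul, augV_e0, mul_zero, add_zero] at hu'
    exact hu'
  have h := congrArg augWW hc
  rw [augWW_DeltaW, map_add, map_add, augWW_tmul, augWW_tmul, ha, map_smul, map_one] at h
  have hc0 : c = 0 := by simpa using h.symm
  rw [hc, hc0, zero_smul, add_zero]

end HarmonicStab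

end

theorem theorem6p1 :
    (HarmonicStab.stabW : LieSubalgebra ℚ HarmonicStab.gDR) = HarmonicStab.stabM := by
  ext g
  rw [HarmonicStab.mem_stabW_iff, HarmonicStab.mem_stabM_iff]
  refine forall_congr' fun d => ?_
  obtain ⟨a, b, h⟩ := HarmonicStab.exists_eq_W_add_mul_e0 (HarmonicStab.gammaComp g d).2
  rw [HarmonicStab.derM_stab_iff _ h]
  refine ⟨fun H => ⟨H, HarmonicStab.DeltaW_eq_of_stab _ h ?_ H⟩, fun H => H.1⟩
  -- The Lie property of x enters only here, through the absence of a constant term.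
  exact (HarmonicStab.augV_theta _).trans (HarmonicStab.augV_lie (g.left.comp_mem d).1)
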